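/- Let $\Omega\subset\mathbb{R}^2$ be a bounded domain (a non-empty, connected, bounded open set) and let $-\pi<\theta_m<\theta_M<\pi$ with $\theta_M\neq\theta_m+\pi$. Assume that $0\in\partial\Omega$ and that there is an open ball $B$ centred at $0$ with $\Omega\cap B=\mathcal C\cap B$, where \[ \mathcal C=\{x\in\mathbb{R}^2 \mid x\neq 0,\ \theta_m<\arg(x_1+ix_2)<\theta_M\},\qquad \arg\in(-\pi,\pi], \] is a cone with vertex $0$ and opening angle $\theta_M-\theta_m\in(0,2\pi)\setminus\{\pi\}$. Let $u,u'\in H^2(\Omega\cap B)$ be complex-valued, let $\alpha>0$, and let the complex-valued functions $f,f'$ be Hölder continuous with exponent $\alpha$ on $\overline{\Omega\cap B}$. Suppose that \[ \Delta u=f,\qquad \Delta u'=f'\qquad\text{in }\Omega\cap B, \] in the sense of weak derivatives. If $u=u'$ and $\partial_\nu u=\partial_\nu u'$ on $\partial\Omega\cap B$ in the sense of traces, where $\nu$ is the outward unit normal (defined almost everywhere with respect to arc length) and $\partial_\nu u=\nu\cdot\nabla u$, then \[ f(0)=f'(0). \] -/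

import Mathlib

open MeasureTheory Filter Topology
open scoped NNReal ENNReal ContDiff

/-- The Euclidean plane. -/
abbrev Plane : Type := EuclideanSpace ℝ (Fin 2)

/-- The open cone with vertex `0` bounded by the rays at angles `θm` and `θM`,
`{x ≠ 0 | θm < arg (x₁ + i x₂) < θM}`, the argument being taken in `(-π, π]`. -/
def planeCone (θm θM : ℝ) : Set Plane :=
  {x | x ≠ 0 ∧ θm < Complex.arg ⟨x 0, x 1⟩ ∧ Complex.arg ⟨x 0, x 1⟩ < θM}

/-- The classical partial derivative `∂ᵢ φ` at `x`. -/
noncomputable def partialDeriv {F : Type*} [NormedAddCommGroup F] [NormedSpace ℝ F]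
    (i : Fin 2) (φ : Plane → F) (x : Plane) : F :=
  fderiv ℝ φ x (EuclideanSpace.single i (1 : ℝ))

/-- Test functions on `U`: smooth, with compact support contained in `U`. -/
def IsTestFunction (U : Set Plane) (φ : Plane → ℝ) : Prop :=
  ContDiff ℝ ∞ φ ∧ HasCompactSupport φ ∧ tsupport φ ⊆ U

/-- `v` is a weak partial derivative `∂ᵢ u` in the open set `U`. -/
def HasWeakPartial (U : Set Plane) (i : Fin 2) (u v : Plane → ℂ) : Prop :=
  LocallyIntegrableOn u U volume ∧ LocallyIntegrableOn v U volume ∧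
    ∀ φ : Plane → ℝ, IsTestFunction U φ →
      ∫ x in U, partialDeriv i φ x • u x = -∫ x in U, φ x • v x

/-- The Sobolev space `H¹(U)`: `u` and its weak first derivatives are in `L²(U)`. -/
def MemH1 (U : Set Plane) (u : Plane → ℂ) : Prop :=
  MemLp u 2 (volume.restrict U) ∧
    ∀ i, ∃ v, HasWeakPartial U i u v ∧ MemLp v 2 (volume.restrict U)

/-- The Sobolev space `H²(U)`: `u ∈ L²(U)` has weak first derivatives, all of them in `H¹(U)`. -/
def MemH2 (U : Set Plane) (u : Plane → ℂ) : Prop :=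
  MemLp u 2 (volume.restrict U) ∧ ∀ i, ∃ v, HasWeakPartial U i u v ∧ MemH1 U v

/-- `Δ u = f` in `U`: the weak second derivatives `∂ᵢ ∂ᵢ u = d i` exist and sum to `f`
almost everywhere in `U`. -/
def SolvesPoisson (U : Set Plane) (u f : Plane → ℂ) : Prop :=
  ∃ v d : Fin 2 → Plane → ℂ,
    (∀ i, HasWeakPartial U i u (v i)) ∧ (∀ i, HasWeakPartial U i (v i) (d i)) ∧
      ∀ᵐ x ∂(volume.restrict U), ∑ i, d i x = f x

/-- The arc length measure on a subset `Γ` of the plane. -/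
noncomputable def arcMeasure (Γ : Set Plane) : Measure Plane :=
  (Measure.hausdorffMeasure 1 : Measure Plane).restrict Γ

/-- `g ∈ L²(Γ)` is the trace on `Γ ⊆ ∂U` of `u ∈ H¹(U)`, where the trace operator is the
extension by continuity of `φ ↦ φ|_Γ` from smooth functions: some functions `φ n`, smooth up to
the boundary, converge to `u` in `H¹(U)` while their restrictions to `Γ` converge to `g`
in `L²(Γ)`. -/
def HasTrace (U Γ : Set Plane) (u g : Plane → ℂ) : Prop :=
  MemH1 U u ∧ MemLp g 2 (arcMeasure Γ) ∧
    ∃ φ : ℕ → Plane → ℂ,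
      (∀ n, ContDiff ℝ ∞ (φ n)) ∧
      Tendsto (fun n => eLpNorm (fun x => φ n x - u x) 2 (volume.restrict U)) atTop (𝓝 0) ∧
      (∀ i, ∃ v, HasWeakPartial U i u v ∧
        Tendsto (fun n => eLpNorm (fun x => partialDeriv i (φ n) x - v x) 2
          (volume.restrict U)) atTop (𝓝 0)) ∧
      Tendsto (fun n => eLpNorm (fun x => φ n x - g x) 2 (arcMeasure Γ)) atTop (𝓝 0)

/-- `ν` is the outward unit normal of `U` at the boundary point `x`: near `x`, the set `U`
agrees, up to double cones of arbitrarily small aperture around the tangent line, with the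
half-plane `{y | ⟪y - x, ν⟫ < 0}`. -/
def IsOutwardUnitNormal (U : Set Plane) (x ν : Plane) : Prop :=
  ‖ν‖ = 1 ∧ ∀ ε : ℝ, 0 < ε → ∀ᶠ y in 𝓝 x,
    (ε * ‖y - x‖ < inner ℝ (y - x) ν → y ∉ U) ∧
    (inner ℝ (y - x) ν < -(ε * ‖y - x‖) → y ∈ U)

/-- `h` is the normal derivative `∂_ν u = ν · ∇u` on `Γ ⊆ ∂U` of `u ∈ H²(U)`, the gradient being
taken in the sense of traces and `ν` being the outward unit normal of `U`, which on a piecewise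
smooth `Γ` exists almost everywhere. -/
def HasNormalDerivative (U Γ : Set Plane) (u h : Plane → ℂ) : Prop :=
  ∃ v G : Fin 2 → Plane → ℂ,
    (∀ i, HasWeakPartial U i u (v i)) ∧ (∀ i, HasTrace U Γ (v i) (G i)) ∧
      ∀ᵐ x ∂(arcMeasure Γ), ∀ ν : Plane, IsOutwardUnitNormal U x ν →
        h x = ∑ i, (ν i : ℂ) * G i x

/-- `u = u'` and `∂_ν u = ∂_ν u'` on `Γ ⊆ ∂U`, in the sense of traces. -/
def SameCauchyData (U Γ : Set Plane) (u u' : Plane → ℂ) : Prop :=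
  (∃ g, HasTrace U Γ u g ∧ HasTrace U Γ u' g) ∧
    ∃ h, HasNormalDerivative U Γ u h ∧ HasNormalDerivative U Γ u' h

/-! Let `w = u - u'` and `g = f - f'`. Then `Δw = g` near the vertex, and `w` and `∂_ν w` have zero
trace on both sides of the cone. Writing `z = x₁ + i x₂`, one tests this equation against the
harmonic functions `z ^ s` with complex exponent `s`, cut off by `χ = (R⁴ - |x|⁴)²`. The double zero
of `χ` on the arc `|x| = R` removes the boundary terms there, the zero Cauchy data remove those on
the sides, and for `Re s > 2` everything is regular enough at the vertex for two integrations by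
parts (`integral_laplacian_mul_cpow`): `∫ g χ z ^ s = ∫ w Δ(χ z ^ s)`.

Both sides make sense far beyond `Re s > 2`. Since `z ^ s` is harmonic and homogeneous of degree
`s`, `Δ(χ z ^ s) = (Δχ + 2 s c) z ^ s`, where `∇χ = c x`. As `χ` differs from a constant by
`O(|x|⁴)`, this Laplacian is `O(|x| ^ (Re s + 2))`. So with `w` merely integrable the right side is
holomorphic on `Re s > -2` and stays bounded as `s` decreases to `-2` along the real axis. The left
side is also holomorphic there, and the identity theorem extends the equality
(`differentiableOn_integral_mul_cpow`).

At `s = -2` the left side would have a simple pole. Indeed `g χ = g(0) R⁸ + O(|x| ^ min α 4)` by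
Hölder continuity, the error contributes a bounded term, and by `integral_cpow_planeSector` the
quantity `(s + 2) ∫ z ^ s` tends to `(e^(-2iθM) - e^(-2iθm)) / (-2i)`. This is nonzero exactly
because the opening angle is not `π` (`exp_neg_two_angle_ne`). Boundedness forces `g(0) = 0`, which
is `vertex_value_eq_zero`. -/

/-! ### Polar coordinates and circular sectors -/

/-- The identification of the plane with `ℂ`. -/
noncomputable def planeToComplex : Plane ≃ₗᵢ[ℝ] ℂ := Complex.orthonormalBasisOneI.repr.symm

lemma planeToComplex_apply (x : Plane) : planeToComplex x = ⟨x 0, x 1⟩ := by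
  rw [planeToComplex, Complex.orthonormalBasisOneI_repr_symm_apply]
  apply Complex.ext <;> simp

/-- The point with polar coordinates `(ρ, θ)`. -/
noncomputable def polarPoint (ρ θ : ℝ) : Plane := !₂[ρ * Real.cos θ, ρ * Real.sin θ]

@[simp] lemma polarPoint_apply_zero (ρ θ : ℝ) : polarPoint ρ θ 0 = ρ * Real.cos θ := rfl

@[simp] lemma polarPoint_apply_one (ρ θ : ℝ) : polarPoint ρ θ 1 = ρ * Real.sin θ := rfl

lemma planeToComplex_polarPoint (ρ θ : ℝ) :
    planeToComplex (polarPoint ρ θ) = ρ * (Real.cos θ + Real.sin θ * Complex.I) := by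
  rw [planeToComplex_apply]
  apply Complex.ext <;> simp [-Complex.ofReal_cos, -Complex.ofReal_sin]

lemma norm_polarPoint (ρ θ : ℝ) : ‖polarPoint ρ θ‖ = |ρ| := by
  rw [← planeToComplex.norm_map, planeToComplex_polarPoint]
  simp

lemma polarPoint_zero (θ : ℝ) : polarPoint 0 θ = 0 := by
  rw [← norm_eq_zero, norm_polarPoint, abs_zero]

lemma arg_polarPoint {ρ θ : ℝ} (hρ : 0 < ρ) (hθ : θ ∈ Set.Ioc (-Real.pi) Real.pi) :
    Complex.arg (planeToComplex (polarPoint ρ θ)) = θ := by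
  rw [planeToComplex_polarPoint]
  simpa using Complex.arg_mul_cos_add_sin_mul_I hρ hθ

lemma polarPoint_norm_arg (x : Plane) :
    polarPoint ‖x‖ (Complex.arg (planeToComplex x)) = x := by
  apply planeToComplex.injective
  rw [planeToComplex_polarPoint, ← planeToComplex.norm_map x]
  simpa using Complex.norm_mul_cos_add_sin_mul_I (planeToComplex x)

lemma continuous_polarPoint : Continuous fun p : ℝ × ℝ => polarPoint p.1 p.2 := by
  apply planeToComplex.symm.continuous.comp (g := planeToComplex.symm)
    (f := fun p : ℝ × ℝ => (p.1 * (Real.cos p.2 + Real.sin p.2 * Complex.I) : ℂ)) (by fun_prop) |>.congr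
  intro p
  rw [Function.comp_apply, ← planeToComplex_polarPoint, LinearIsometryEquiv.symm_apply_apply]

lemma mem_planeCone {θm θM : ℝ} {x : Plane} : x ∈ planeCone θm θM ↔
    x ≠ 0 ∧ θm < Complex.arg (planeToComplex x) ∧ Complex.arg (planeToComplex x) < θM := by
  rw [planeToComplex_apply]; rfl

/-- The part of the cone within distance `R` of the vertex. -/
def planeSector (θm θM R : ℝ) : Set Plane := planeCone θm θM ∩ Metric.ball 0 R

lemma mem_planeSector {θm θM R : ℝ} {x : Plane} : x ∈ planeSector θm θM R ↔
    (x ≠ 0 ∧ θm < Complex.arg (planeToComplex x) ∧ Complex.arg (planeToComplex x) < θM) ∧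
      ‖x‖ < R := by
  rw [planeSector, Set.mem_inter_iff, mem_planeCone, mem_ball_zero_iff]

lemma polarPoint_mem_planeSector {θm θM R ρ θ : ℝ} (hθ : θ ∈ Set.Ioc (-Real.pi) Real.pi)
    (hρ : 0 < ρ) : polarPoint ρ θ ∈ planeSector θm θM R ↔ θ ∈ Set.Ioo θm θM ∧ ρ < R := by
  rw [mem_planeSector, arg_polarPoint hρ hθ, norm_polarPoint, abs_of_pos hρ, ← norm_ne_zero_iff,
    norm_polarPoint, abs_of_pos hρ, Set.mem_Ioo]
  simp [hρ.ne']

lemma slitPlane_of_mem_planeSector {θm θM R : ℝ} (hθM : θM < Real.pi) {x : Plane}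
    (hx : x ∈ planeSector θm θM R) : planeToComplex x ∈ Complex.slitPlane := by
  rw [mem_planeSector] at hx
  rw [Complex.mem_slitPlane_iff_arg]
  exact ⟨by linarith [hx.1.2.2], by simpa using hx.1.1⟩

lemma slitPlane_polarPoint {ρ θ : ℝ} (hρ : 0 < ρ) (hθ : θ ∈ Set.Ioo (-Real.pi) Real.pi) :
    planeToComplex (polarPoint ρ θ) ∈ Complex.slitPlane := by
  rw [Complex.mem_slitPlane_iff_arg, arg_polarPoint hρ ⟨hθ.1, hθ.2.le⟩]
  refine ⟨hθ.2.ne, fun h => ?_⟩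
  rw [map_eq_zero_iff _ planeToComplex.injective, ← norm_eq_zero, norm_polarPoint,
    abs_of_pos hρ] at h
  exact hρ.ne' h

lemma isOpen_planeSector {θm θM : ℝ} (hθM : θM < Real.pi) (R : ℝ) :
    IsOpen (planeSector θm θM R) := by
  have : planeSector θm θM R = planeToComplex ⁻¹' (Complex.slitPlane ∩
      Complex.arg ⁻¹' Set.Ioo θm θM) ∩ Metric.ball 0 R := by
    ext x
    constructor
    · intro hx
      refine ⟨⟨slitPlane_of_mem_planeSector hθM hx, ?_⟩, hx.2⟩
      exact (mem_planeSector.1 hx).1.2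
    · rintro ⟨⟨h1, h2⟩, h3⟩
      rw [mem_planeSector]
      refine ⟨⟨?_, h2⟩, mem_ball_zero_iff.1 h3⟩
      rintro rfl
      simp at h1
  rw [this]
  refine IsOpen.inter (IsOpen.preimage planeToComplex.continuous ?_) Metric.isOpen_ball
  have hc : ContinuousOn Complex.arg Complex.slitPlane := fun z hz =>
    (Complex.continuousAt_arg hz).continuousWithinAt
  exact hc.isOpen_inter_preimage Complex.isOpen_slitPlane isOpen_Ioo

lemma integral_plane_polar {E : Type*} [NormedAddCommGroup E] [NormedSpace ℝ E] (F : Plane → E) :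
    ∫ p in Set.Ioi (0 : ℝ) ×ˢ Set.Ioo (-Real.pi) Real.pi, p.1 • F (polarPoint p.1 p.2) =
      ∫ x, F x := by
  have h := Complex.integral_comp_polarCoord_symm (fun z => F (planeToComplex.symm z))
  rw [planeToComplex.symm.measurePreserving.integral_comp
    planeToComplex.symm.toHomeomorph.measurableEmbedding] at h
  rw [← h]
  simp only [Complex.polarCoord_symm_apply, ← planeToComplex_polarPoint,
    LinearIsometryEquiv.symm_apply_apply, polarCoord_target]

/-- As the angles stay strictly inside `(-π, π)`, the sector is a rectangle in polar coordinates and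
never meets the branch cut of `arg`. -/
lemma setIntegral_planeSector {E : Type*} [NormedAddCommGroup E] [NormedSpace ℝ E]
    {θm θM : ℝ} (hθm : -Real.pi < θm) (hθM : θM < Real.pi) (R : ℝ) (F : Plane → E) :
    ∫ x in planeSector θm θM R, F x =
      ∫ p in Set.Ioo 0 R ×ˢ Set.Ioo θm θM, p.1 • F (polarPoint p.1 p.2) := by
  rw [← integral_indicator (isOpen_planeSector hθM R).measurableSet, ← integral_plane_polar,
    ← integral_indicator (measurableSet_Ioi.prod measurableSet_Ioo),
    ← integral_indicator (measurableSet_Ioo.prod measurableSet_Ioo)]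
  congr 1
  ext ⟨ρ, θ⟩
  by_cases h : (ρ, θ) ∈ Set.Ioi (0 : ℝ) ×ˢ Set.Ioo (-Real.pi) Real.pi
  · rw [Set.indicator_of_mem h]
    have h' := polarPoint_mem_planeSector (θm := θm) (θM := θM) (R := R) ⟨h.2.1, h.2.2.le⟩ h.1
    by_cases h2 : polarPoint ρ θ ∈ planeSector θm θM R
    · rw [Set.indicator_of_mem h2, Set.indicator_of_mem]
      exact ⟨⟨h.1, (h'.1 h2).2⟩, (h'.1 h2).1⟩
    · rw [Set.indicator_of_notMem h2, Set.indicator_of_notMem, smul_zero]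
      exact fun h3 => h2 (h'.2 ⟨h3.2, h3.1.2⟩)
  · rw [Set.indicator_of_notMem h, Set.indicator_of_notMem]
    exact fun h3 => h ⟨h3.1.1, by linarith [h3.2.1], by linarith [h3.2.2]⟩

/-! ### The divergence theorem on a sector -/

/-- The unit normal to the ray at angle `θ`, pointing towards increasing angles. -/
noncomputable def rayNormal (θ : ℝ) : Plane := !₂[-Real.sin θ, Real.cos θ]

@[simp] lemma rayNormal_apply_zero (θ : ℝ) : rayNormal θ 0 = -Real.sin θ := rfl

@[simp] lemma rayNormal_apply_one (θ : ℝ) : rayNormal θ 1 = Real.cos θ := rfl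

lemma norm_rayNormal (θ : ℝ) : ‖rayNormal θ‖ = 1 := by
  rw [EuclideanSpace.norm_eq, Real.sqrt_eq_one]
  simp [Fin.sum_univ_two]

lemma inner_polarPoint_rayNormal (ρ φ θ : ℝ) :
    inner ℝ (polarPoint ρ φ) (rayNormal θ) = ρ * Real.sin (φ - θ) := by
  simp [PiLp.inner_apply, Fin.sum_univ_two, Real.sin_sub]
  ring

/-- Chain rule: the two coefficients are the derivative of `F` in the radial direction and `ρ` times
its derivative in the direction `rayNormal θ`. -/
lemma hasFDerivAt_plane_comp_polarPoint {F : Plane → ℂ} {F0 F1 : ℂ} {p : ℝ × ℝ}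
    (hF : HasFDerivAt F ((EuclideanSpace.proj 0 : Plane →L[ℝ] ℝ).smulRight F0 +
      (EuclideanSpace.proj 1 : Plane →L[ℝ] ℝ).smulRight F1) (polarPoint p.1 p.2)) :
    HasFDerivAt (fun q : ℝ × ℝ => F (polarPoint q.1 q.2))
      ((ContinuousLinearMap.fst ℝ ℝ ℝ).smulRight
          ((Real.cos p.2 : ℂ) * F0 + (Real.sin p.2 : ℂ) * F1) +
        (ContinuousLinearMap.snd ℝ ℝ ℝ).smulRight
          ((p.1 : ℂ) * (-(Real.sin p.2 : ℂ) * F0 + (Real.cos p.2 : ℂ) * F1))) p := by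
  have hc : HasFDerivAt (fun q : ℝ × ℝ => q.1 * Real.cos q.2) (p.1 • (-Real.sin p.2) •
      ContinuousLinearMap.snd ℝ ℝ ℝ + Real.cos p.2 • ContinuousLinearMap.fst ℝ ℝ ℝ) p :=
    hasFDerivAt_fst.mul ((Real.hasDerivAt_cos p.2).comp_hasFDerivAt p hasFDerivAt_snd)
  have hs : HasFDerivAt (fun q : ℝ × ℝ => q.1 * Real.sin q.2) (p.1 • (Real.cos p.2) •
      ContinuousLinearMap.snd ℝ ℝ ℝ + Real.sin p.2 • ContinuousLinearMap.fst ℝ ℝ ℝ) p :=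
    hasFDerivAt_fst.mul ((Real.hasDerivAt_sin p.2).comp_hasFDerivAt p hasFDerivAt_snd)
  have hq : HasFDerivAt (fun q : ℝ × ℝ => polarPoint q.1 q.2)
      (((p.1 • (-Real.sin p.2) •
      ContinuousLinearMap.snd ℝ ℝ ℝ + Real.cos p.2 • ContinuousLinearMap.fst ℝ ℝ ℝ).smulRight
        (EuclideanSpace.single 0 1 : Plane)) + ((p.1 • (Real.cos p.2) •
      ContinuousLinearMap.snd ℝ ℝ ℝ + Real.sin p.2 • ContinuousLinearMap.fst ℝ ℝ ℝ).smulRight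
        (EuclideanSpace.single 1 1 : Plane))) p := by
    refine ((hc.smul_const (EuclideanSpace.single 0 1 : Plane)).add
      (hs.smul_const (EuclideanSpace.single 1 1 : Plane))).congr_of_eventuallyEq ?_
    refine Eventually.of_forall fun q => ?_
    ext i
    fin_cases i <;> simp
  refine (hF.comp p hq).congr_fderiv ?_
  ext
  · simp
  · simp
    ring

/-- The plane slit along the negative real axis, with the origin added. -/
def slitDomain : Set Plane := planeToComplex ⁻¹' (insert 0 Complex.slitPlane)

lemma polarPoint_mem_slitDomain {ρ θ : ℝ} (hρ : 0 ≤ ρ) (hθ : θ ∈ Set.Ioo (-Real.pi) Real.pi) :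
    polarPoint ρ θ ∈ slitDomain := by
  rcases hρ.eq_or_lt with rfl | h
  · left
    rw [polarPoint_zero, map_zero]
  · exact Or.inr (slitPlane_polarPoint h hθ)

lemma planeSector_subset_slitDomain {θm θM R : ℝ} (hθM : θM < Real.pi) :
    planeSector θm θM R ⊆ slitDomain :=
  fun _ hx => Or.inr (slitPlane_of_mem_planeSector hθM hx)

/-- The linear form on the plane with components `a`, `b`. -/
noncomputable def planeForm (a b : ℂ) : Plane →L[ℝ] ℂ :=
  (EuclideanSpace.proj 0 : Plane →L[ℝ] ℝ).smulRight a +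
    (EuclideanSpace.proj 1 : Plane →L[ℝ] ℝ).smulRight b

/-- The divergence theorem on a circular sector, for fields vanishing on the arc. -/
theorem integral_divergence_planeSector {θm θM R : ℝ} (hθm : -Real.pi < θm) (hθ : θm < θM)
    (hθM : θM < Real.pi) (hR : 0 < R) {F : Fin 2 → Plane → ℂ} {D : Fin 2 → Fin 2 → Plane → ℂ}
    (hFc : ∀ i, ContinuousOn (F i) slitDomain)
    (hD : ∀ i x, planeToComplex x ∈ Complex.slitPlane →
      HasFDerivAt (F i) (planeForm (D i 0 x) (D i 1 x)) x)
    (hDc : ∀ i, ContinuousOn (D i i) slitDomain)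
    (hFR : ∀ i x, ‖x‖ = R → F i x = 0) :
    ∫ x in planeSector θm θM R, ∑ i, D i i x =
      (∫ ρ in (0 : ℝ)..R, ∑ i, (rayNormal θM i : ℂ) * F i (polarPoint ρ θM)) -
        ∫ ρ in (0 : ℝ)..R, ∑ i, (rayNormal θm i : ℂ) * F i (polarPoint ρ θm) := by
  have hmaps : Set.MapsTo (fun p : ℝ × ℝ => polarPoint p.1 p.2)
      (Set.uIcc 0 R ×ˢ Set.uIcc θm θM) slitDomain := by
    rw [Set.uIcc_of_le hR.le, Set.uIcc_of_le hθ.le]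
    rintro ⟨ρ, θ⟩ ⟨h1, h2⟩
    exact polarPoint_mem_slitDomain h1.1 ⟨hθm.trans_le h2.1, h2.2.trans_lt hθM⟩
  have hcomp : ∀ {G : Plane → ℂ}, ContinuousOn G slitDomain →
      ContinuousOn (fun p : ℝ × ℝ => G (polarPoint p.1 p.2))
        (Set.uIcc 0 R ×ˢ Set.uIcc θm θM) := fun hG =>
    hG.comp continuous_polarPoint.continuousOn hmaps
  have hcos : Continuous fun p : ℝ × ℝ => (Real.cos p.2 : ℂ) := by fun_prop
  have hsin : Continuous fun p : ℝ × ℝ => (Real.sin p.2 : ℂ) := by fun_prop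
  have hfst : Continuous fun p : ℝ × ℝ => (p.1 : ℂ) := by fun_prop
  have hF0 := hcomp (hFc 0)
  have hF1 := hcomp (hFc 1)
  have hdcos : ∀ p : ℝ × ℝ, HasFDerivAt (fun q : ℝ × ℝ => (Real.cos q.2 : ℂ))
      ((ContinuousLinearMap.snd ℝ ℝ ℝ).smulRight (-(Real.sin p.2 : ℂ))) p := fun p =>
    (((Real.hasDerivAt_cos p.2).ofReal_comp.congr_deriv (by push_cast; rfl)).hasFDerivAt.comp p
      hasFDerivAt_snd).congr_fderiv (by ext <;> simp)
  have hdsin : ∀ p : ℝ × ℝ, HasFDerivAt (fun q : ℝ × ℝ => (Real.sin q.2 : ℂ))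
      ((ContinuousLinearMap.snd ℝ ℝ ℝ).smulRight (Real.cos p.2 : ℂ)) p := fun p =>
    ((Real.hasDerivAt_sin p.2).ofReal_comp.hasFDerivAt.comp p
      hasFDerivAt_snd).congr_fderiv (by ext <;> simp)
  have hdfst : ∀ p : ℝ × ℝ, HasFDerivAt (fun q : ℝ × ℝ => (q.1 : ℂ))
      ((ContinuousLinearMap.fst ℝ ℝ ℝ).smulRight (1 : ℂ)) p := fun p =>
    (((hasDerivAt_id p.1).ofReal_comp).hasFDerivAt.comp p
      hasFDerivAt_fst).congr_fderiv (by ext <;> simp)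
  have hdF : ∀ (i) (p : ℝ × ℝ), p ∈ Set.Ioo (min 0 R) (max 0 R) ×ˢ
      Set.Ioo (min θm θM) (max θm θM) → _ := fun i p hp =>
    hasFDerivAt_plane_comp_polarPoint (F := F i) (p := p) (hD i _ (by
      rw [min_eq_left hR.le, max_eq_right hR.le, min_eq_left hθ.le, max_eq_right hθ.le] at hp
      exact slitPlane_polarPoint hp.1.1 ⟨hθm.trans hp.2.1, hp.2.2.trans hθM⟩))
  -- The field on the polar rectangle has components `ρ (F · e_ρ)` and `F · e_θ`; the weight `ρ`
  -- makes its rectangular divergence equal to `ρ div F`.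
  obtain ⟨f', hf', hf'1⟩ : ∃ f' : ℝ × ℝ → ℝ × ℝ →L[ℝ] ℂ, (∀ p ∈ Set.Ioo (min 0 R) (max 0 R) ×ˢ
      Set.Ioo (min θm θM) (max θm θM), HasFDerivAt (fun p : ℝ × ℝ => (p.1 : ℂ) *
        ((Real.cos p.2 : ℂ) * F 0 (polarPoint p.1 p.2) +
          (Real.sin p.2 : ℂ) * F 1 (polarPoint p.1 p.2))) (f' p) p) ∧
      ∀ p, f' p (1, 0) = ((Real.cos p.2 : ℂ) * F 0 (polarPoint p.1 p.2) +
          (Real.sin p.2 : ℂ) * F 1 (polarPoint p.1 p.2)) + (p.1 : ℂ) *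
        ((Real.cos p.2 : ℂ) * ((Real.cos p.2 : ℂ) * D 0 0 (polarPoint p.1 p.2) +
            (Real.sin p.2 : ℂ) * D 0 1 (polarPoint p.1 p.2)) +
          (Real.sin p.2 : ℂ) * ((Real.cos p.2 : ℂ) * D 1 0 (polarPoint p.1 p.2) +
            (Real.sin p.2 : ℂ) * D 1 1 (polarPoint p.1 p.2))) :=
    ⟨_, fun p hp => (hdfst p).mul
      (((hdcos p).mul (hdF 0 p hp)).add ((hdsin p).mul (hdF 1 p hp))), fun p => by
        simp [-Complex.ofReal_cos, -Complex.ofReal_sin]; ring⟩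
  obtain ⟨g', hg', hg'1⟩ : ∃ g' : ℝ × ℝ → ℝ × ℝ →L[ℝ] ℂ, (∀ p ∈ Set.Ioo (min 0 R) (max 0 R) ×ˢ
      Set.Ioo (min θm θM) (max θm θM), HasFDerivAt (fun p : ℝ × ℝ =>
        -(Real.sin p.2 : ℂ) * F 0 (polarPoint p.1 p.2) +
          (Real.cos p.2 : ℂ) * F 1 (polarPoint p.1 p.2)) (g' p) p) ∧
      ∀ p, g' p (0, 1) = -((Real.cos p.2 : ℂ) * F 0 (polarPoint p.1 p.2) +
          (Real.sin p.2 : ℂ) * F 1 (polarPoint p.1 p.2)) + (p.1 : ℂ) *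
        (-(Real.sin p.2 : ℂ) * (-(Real.sin p.2 : ℂ) * D 0 0 (polarPoint p.1 p.2) +
            (Real.cos p.2 : ℂ) * D 0 1 (polarPoint p.1 p.2)) +
          (Real.cos p.2 : ℂ) * (-(Real.sin p.2 : ℂ) * D 1 0 (polarPoint p.1 p.2) +
            (Real.cos p.2 : ℂ) * D 1 1 (polarPoint p.1 p.2))) :=
    ⟨_, fun p hp => ((hdsin p).neg.mul (hdF 0 p hp)).add ((hdcos p).mul (hdF 1 p hp)), fun p => by
        simp [-Complex.ofReal_cos, -Complex.ofReal_sin]; ring⟩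
  -- The undifferentiated terms `F · e_ρ`, one from the weight `ρ` and one from rotating the frame,
  -- cancel; `sin² + cos² = 1` turns the rest into the trace of `D`.
  have hsum : ∀ p : ℝ × ℝ, f' p (1, 0) + g' p (0, 1) =
      p.1 • ∑ i, D i i (polarPoint p.1 p.2) := by
    intro p
    rw [hf'1, hg'1, Fin.sum_univ_two, Complex.real_smul]
    have h1 : (Real.sin p.2 : ℂ) ^ 2 + (Real.cos p.2 : ℂ) ^ 2 = 1 := by
      exact_mod_cast congrArg Complex.ofReal (Real.sin_sq_add_cos_sq p.2)
    linear_combination ((p.1 : ℂ) * (D 0 0 (polarPoint p.1 p.2) + D 1 1 (polarPoint p.1 p.2))) * h1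
  have hcont : ContinuousOn (fun p : ℝ × ℝ => f' p (1, 0) + g' p (0, 1))
      (Set.uIcc 0 R ×ˢ Set.uIcc θm θM) := by
    simp only [hsum]
    exact continuous_fst.continuousOn.smul
      (continuousOn_finsetSum _ fun i _ => hcomp (hDc i))
  have hint := hcont.integrableOn_compact (μ := volume)
    (isCompact_uIcc.prod isCompact_uIcc)
  have key := integral2_divergence_prod_of_hasFDerivAt _ _ f' g' 0 θm R θM
      (hfst.continuousOn.mul ((hcos.continuousOn.mul hF0).add (hsin.continuousOn.mul hF1)))
      ((hsin.neg.continuousOn.mul hF0).add (hcos.continuousOn.mul hF1)) hf' hg' hint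
  -- Of the four edges, `ρ = 0` drops out through the factor `ρ`, and `ρ = R` through the vanishing
  -- of `F` on the arc. Only the two sides remain.
  have hvan : ∀ i θ, F i (polarPoint R θ) = 0 := fun i θ =>
    hFR i _ (by rw [norm_polarPoint, abs_of_pos hR])
  simp only [hsum] at key
  rw [setIntegral_planeSector hθm hθM]
  have hint' : IntegrableOn (fun p : ℝ × ℝ => p.1 • ∑ i, D i i (polarPoint p.1 p.2))
      (Set.Ioc 0 R ×ˢ Set.Ioc θm θM) := by
    simp only [hsum] at hint
    refine hint.mono_set ?_
    rw [Set.uIcc_of_le hR.le, Set.uIcc_of_le hθ.le]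
    exact Set.prod_mono Set.Ioc_subset_Icc_self Set.Ioc_subset_Icc_self
  have hL : ∫ p in Set.Ioo 0 R ×ˢ Set.Ioo θm θM, p.1 • ∑ i, D i i (polarPoint p.1 p.2) =
      ∫ x in (0 : ℝ)..R, ∫ y in θm..θM, x • ∑ i, D i i (polarPoint x y) := by
    rw [intervalIntegral.integral_of_le hR.le]
    simp only [intervalIntegral.integral_of_le hθ.le]
    rw [Measure.volume_eq_prod, ← setIntegral_prod _ hint']
    exact setIntegral_congr_set (Measure.set_prod_ae_eq Ioo_ae_eq_Ioc Ioo_ae_eq_Ioc)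
  rw [hL, key]
  simp [Fin.sum_univ_two, hvan]

/-! ### Outward normals and arc length on the sides -/

lemma inner_rayNormal (y : Plane) (θ : ℝ) : inner ℝ y (rayNormal θ) =
    ‖y‖ * Real.sin (Complex.arg (planeToComplex y) - θ) := by
  conv_lhs => rw [← polarPoint_norm_arg y]
  rw [inner_polarPoint_rayNormal]

lemma eventually_norm_arg_near {r ρ θ ε : ℝ} (hρ : 0 < ρ) (hρr : ρ < r)
    (hθ : θ ∈ Set.Ioo (-Real.pi) Real.pi) (hε : 0 < ε) :
    ∀ᶠ y in 𝓝 (polarPoint ρ θ), 0 < ‖y‖ ∧ ‖y‖ < r ∧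
      |Complex.arg (planeToComplex y) - θ| < ε := by
  have h1 : ContinuousAt (fun y => Complex.arg (planeToComplex y)) (polarPoint ρ θ) :=
    (Complex.continuousAt_arg (slitPlane_polarPoint hρ hθ)).comp
      planeToComplex.continuous.continuousAt
  have h2 : Tendsto (fun y : Plane => ‖y‖) (𝓝 (polarPoint ρ θ)) (𝓝 ρ) := by
    have := (continuous_norm (E := Plane)).tendsto (polarPoint ρ θ)
    rwa [norm_polarPoint, abs_of_pos hρ] at this
  have h3 := Metric.tendsto_nhds.1 h1 ε hε
  simp only [arg_polarPoint hρ ⟨hθ.1, hθ.2.le⟩, Real.dist_eq] at h3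
  filter_upwards [h2.eventually (lt_mem_nhds hρ), h2.eventually (gt_mem_nhds hρr), h3] with y a b c
  exact ⟨a, b, c⟩

lemma sin_neg_iff_of_abs_lt_pi {δ : ℝ} (h : |δ| < Real.pi) : Real.sin δ < 0 ↔ δ < 0 := by
  rw [abs_lt] at h
  refine ⟨fun hs => ?_, fun hd => Real.sin_neg_of_neg_of_neg_pi_lt hd h.1⟩
  by_contra hd
  exact absurd (Real.sin_nonneg_of_nonneg_of_le_pi (not_lt.1 hd) h.2.le) (not_le.2 hs)

lemma mul_neg_iff_of_pos {a b : ℝ} (ha : 0 < a) : a * b < 0 ↔ b < 0 := by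
  simp [mul_neg_iff, ha, ha.not_gt]

/-- Where the boundary is straight, the set is locally an exact half-plane and the error cones in
the definition play no role. -/
lemma IsOutwardUnitNormal.of_eventually_mem_iff {U : Set Plane} {x ν : Plane} (hν : ‖ν‖ = 1)
    (h : ∀ᶠ y in 𝓝 x, y ∈ U ↔ inner ℝ (y - x) ν < 0) : IsOutwardUnitNormal U x ν := by
  refine ⟨hν, fun ε hε => h.mono fun y hy => ?_⟩
  have := mul_nonneg hε.le (norm_nonneg (y - x))
  rw [hy]
  exact ⟨fun h => by linarith, fun h => by linarith⟩

/-- Near the point, lying in the sector means `arg y < θM`. The argument is kept within `π` of `θM`,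
so that the sine has the sign of the angle difference, and within `θM - θm`, so that the other side
is not reached. -/
lemma isOutwardUnitNormal_upper_ray {θm θM r ρ : ℝ} (hθm : -Real.pi < θm) (hθ : θm < θM)
    (hθM : θM < Real.pi) (hρ : 0 < ρ) (hρr : ρ < r) :
    IsOutwardUnitNormal (planeSector θm θM r) (polarPoint ρ θM) (rayNormal θM) := by
  refine .of_eventually_mem_iff (norm_rayNormal _) ?_
  filter_upwards [eventually_norm_arg_near hρ hρr ⟨hθm.trans hθ, hθM⟩
    (lt_min Real.pi_pos (sub_pos.2 hθ))] with y ⟨h1, h2, h3⟩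
  obtain ⟨h3, h4⟩ := lt_min_iff.1 h3
  rw [inner_sub_left, inner_polarPoint_rayNormal, sub_self, Real.sin_zero, mul_zero, sub_zero,
    inner_rayNormal, mul_neg_iff_of_pos h1, sin_neg_iff_of_abs_lt_pi h3, mem_planeSector,
    ← norm_pos_iff]
  rw [abs_lt] at h4
  constructor
  · rintro ⟨⟨-, -, h⟩, -⟩
    linarith
  · exact fun h => ⟨⟨h1, by linarith, by linarith⟩, h2⟩

lemma isOutwardUnitNormal_lower_ray {θm θM r ρ : ℝ} (hθm : -Real.pi < θm) (hθ : θm < θM)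
    (hθM : θM < Real.pi) (hρ : 0 < ρ) (hρr : ρ < r) :
    IsOutwardUnitNormal (planeSector θm θM r) (polarPoint ρ θm) (-rayNormal θm) := by
  refine .of_eventually_mem_iff (by rw [norm_neg, norm_rayNormal]) ?_
  filter_upwards [eventually_norm_arg_near hρ hρr ⟨hθm, hθ.trans hθM⟩
    (lt_min Real.pi_pos (sub_pos.2 hθ))] with y ⟨h1, h2, h3⟩
  obtain ⟨h3, h4⟩ := lt_min_iff.1 h3
  rw [inner_neg_right, inner_sub_left, inner_polarPoint_rayNormal, sub_self, Real.sin_zero,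
    mul_zero, sub_zero, inner_rayNormal, ← mul_neg, ← Real.sin_neg, mul_neg_iff_of_pos h1,
    sin_neg_iff_of_abs_lt_pi (by rwa [abs_neg]), mem_planeSector, ← norm_pos_iff]
  rw [abs_lt] at h4
  constructor
  · rintro ⟨⟨-, h, -⟩, -⟩
    linarith
  · exact fun h => ⟨⟨h1, by linarith, by linarith⟩, h2⟩

lemma polarPoint_mem_closure_planeSector {θm θM r ρ θ : ℝ} (hθm : -Real.pi < θm) (hθ : θm < θM)
    (hθM : θM < Real.pi) (hρ : 0 < ρ) (hρr : ρ < r) (hθ' : θ ∈ Set.Icc θm θM) :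
    polarPoint ρ θ ∈ closure (planeSector θm θM r) := by
  rw [← closure_Ioo hθ.ne] at hθ'
  refine map_mem_closure (f := fun φ => polarPoint ρ φ)
    (continuous_polarPoint.comp (by fun_prop : Continuous fun φ : ℝ => (ρ, φ))) hθ'
    fun φ hφ => ?_
  exact (polarPoint_mem_planeSector ⟨hθm.trans hφ.1, (hφ.2.trans hθM).le⟩ hρ).2 ⟨hφ, hρr⟩

lemma polarPoint_mem_frontier {Ω : Set Plane} (hΩ : IsOpen Ω) {θm θM r : ℝ}
    (hθm : -Real.pi < θm) (hθ : θm < θM) (hθM : θM < Real.pi)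
    (hcone : Ω ∩ Metric.ball 0 r = planeSector θm θM r) {θ ρ : ℝ}
    (hθ' : θ = θm ∨ θ = θM) (hρ : ρ ∈ Set.Ioo 0 r) :
    polarPoint ρ θ ∈ frontier Ω ∩ Metric.ball 0 r := by
  have hb : polarPoint ρ θ ∈ Metric.ball (0 : Plane) r := by
    rw [mem_ball_zero_iff, norm_polarPoint, abs_of_pos hρ.1]
    exact hρ.2
  refine ⟨?_, hb⟩
  rw [hΩ.frontier_eq]
  constructor
  · refine closure_mono (hcone ▸ Set.inter_subset_left)
      (polarPoint_mem_closure_planeSector hθm hθ hθM hρ.1 hρ.2 ?_)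
    rcases hθ' with rfl | rfl
    · exact ⟨le_rfl, hθ.le⟩
    · exact ⟨hθ.le, le_rfl⟩
  · intro h
    have h' : polarPoint ρ θ ∈ planeSector θm θM r := hcone ▸ ⟨h, hb⟩
    rw [polarPoint_mem_planeSector (by rcases hθ' with rfl | rfl <;> constructor <;> linarith)
      hρ.1] at h'
    rcases hθ' with rfl | rfl
    · exact lt_irrefl _ h'.1.1
    · exact lt_irrefl _ h'.1.2

lemma isometry_polarPoint (θ : ℝ) : Isometry fun ρ => polarPoint ρ θ := by
  refine Isometry.of_dist_eq fun a b => ?_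
  have : polarPoint a θ - polarPoint b θ = polarPoint (a - b) θ := by
    ext i
    fin_cases i <;> simp [sub_mul]
  rw [dist_eq_norm, this, norm_polarPoint, Real.dist_eq]

/-- A ray is parametrized isometrically by `ρ`, and isometries preserve the one-dimensional
Hausdorff measure, which on `ℝ` is Lebesgue measure. Hence statements in `L²(Γ)` or almost
everywhere on `Γ` restrict to each side. -/
lemma map_polarPoint_le_arcMeasure {Γ : Set Plane} {r θ : ℝ}
    (h : ∀ ρ ∈ Set.Ioo 0 r, polarPoint ρ θ ∈ Γ) :
    Measure.map (fun ρ => polarPoint ρ θ) (volume.restrict (Set.Ioo 0 r)) ≤ arcMeasure Γ := by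
  have hi := isometry_polarPoint θ
  refine Measure.le_iff.2 fun s hs => ?_
  rw [Measure.map_apply hi.continuous.measurable hs,
    Measure.restrict_apply (hi.continuous.measurable hs), ← hausdorffMeasure_real,
    ← hi.hausdorffMeasure_image (Or.inl zero_le_one), arcMeasure, Measure.restrict_apply hs]
  refine measure_mono ?_
  rintro _ ⟨ρ, ⟨h1, h2⟩, rfl⟩
  exact ⟨h1, h ρ h2⟩

lemma ae_ray_of_ae_arcMeasure {Γ : Set Plane} {r θ : ℝ}
    (h : ∀ ρ ∈ Set.Ioo 0 r, polarPoint ρ θ ∈ Γ) {P : Plane → Prop}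
    (hP : ∀ᵐ x ∂arcMeasure Γ, P x) :
    ∀ᵐ ρ ∂volume.restrict (Set.Ioo 0 r), P (polarPoint ρ θ) :=
  ae_of_ae_map (isometry_polarPoint θ).continuous.measurable.aemeasurable
    (ae_mono (map_polarPoint_le_arcMeasure h) hP)

lemma eLpNorm_ray_le {Γ : Set Plane} {r θ : ℝ}
    (h : ∀ ρ ∈ Set.Ioo 0 r, polarPoint ρ θ ∈ Γ) {G : Plane → ℂ} {p : ℝ≥0∞}
    (hG : AEStronglyMeasurable G (arcMeasure Γ)) :
    eLpNorm (fun ρ => G (polarPoint ρ θ)) p (volume.restrict (Set.Ioo 0 r)) ≤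
      eLpNorm G p (arcMeasure Γ) := by
  have hle := map_polarPoint_le_arcMeasure h
  have := eLpNorm_map_measure (p := p) (hG.mono_measure hle)
    (isometry_polarPoint θ).continuous.measurable.aemeasurable
  exact this.symm.trans_le (eLpNorm_mono_measure G hle)

/-! ### Green's formula for `L²` limits of smooth fields -/

/-- If `a n → a` in `L²` of a finite measure then integrals against bounded functions converge. -/
lemma tendsto_integral_mul_of_eLpNorm_two {X : Type*} [MeasurableSpace X] {μ : Measure X}
    [IsFiniteMeasure μ] {a : ℕ → X → ℂ} {a' b : X → ℂ} {C : ℝ}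
    (ha : ∀ n, AEStronglyMeasurable (a n) μ) (ha' : MemLp a' 2 μ)
    (hlim : Tendsto (fun n => eLpNorm (fun x => a n x - a' x) 2 μ) atTop (𝓝 0))
    (hb : AEStronglyMeasurable b μ) (hC : ∀ᵐ x ∂μ, ‖b x‖ ≤ C) :
    Tendsto (fun n => ∫ x, a n x * b x ∂μ) atTop (𝓝 (∫ x, a' x * b x ∂μ)) := by
  have hbd : MemLp b ⊤ μ := memLp_top_of_bound hb C hC
  have hlim1 : Tendsto (fun n => eLpNorm (fun x => a n x * b x - a' x * b x) 1 μ)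
      atTop (𝓝 0) := by
    have hK : ∀ n, eLpNorm (fun x => a n x * b x - a' x * b x) 1 μ ≤
        eLpNorm (fun x => a n x - a' x) 2 μ * eLpNorm b 2 μ := by
      intro n
      -- Hölder's inequality with exponents `2, 2`; the bounded factor is in `L²` because the
      -- measure is finite.
      have := eLpNorm_smul_le_mul_eLpNorm (p := 2) (q := 2) (r := 1) hb
        ((ha n).sub ha'.1)
      refine le_of_eq_of_le (congrArg (fun F => eLpNorm F 1 μ) ?_) this
      ext x
      simp [sub_mul]
    have hfin : eLpNorm b 2 μ ≠ ⊤ := (hbd.mono_exponent le_top).2.ne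
    refine tendsto_of_tendsto_of_tendsto_of_le_of_le tendsto_const_nhds ?_ (fun _ => zero_le) hK
    simpa using ENNReal.Tendsto.mul_const hlim (Or.inr hfin)
  have hprod : Integrable (fun x => a' x * b x) μ :=
    (ha'.integrable one_le_two).mul_bdd hb hC
  refine tendsto_integral_of_L1' _ hprod.1 ?_ hlim1
  filter_upwards [hlim1.eventually_lt_const ENNReal.zero_lt_top] with n hn
  have : Integrable (fun x => a n x * b x - a' x * b x) μ :=
    memLp_one_iff_integrable.1 ⟨((ha n).mul hb).sub (ha'.1.mul hb), hn⟩
  exact (this.add hprod).congr (ae_of_all _ fun x => by simp)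

lemma hasFDerivAt_planeForm {φ : Plane → ℂ} {x : Plane} (h : DifferentiableAt ℝ φ x) :
    HasFDerivAt φ (planeForm (partialDeriv 0 φ x) (partialDeriv 1 φ x)) x := by
  refine h.hasFDerivAt.congr_fderiv ?_
  ext y
  have hy : y = y 0 • EuclideanSpace.single 0 (1 : ℝ) + y 1 • EuclideanSpace.single 1 (1 : ℝ) := by
    ext i
    fin_cases i <;> simp
  conv_lhs => rw [hy, map_add, map_smul, map_smul]
  rfl

lemma ContDiff.continuous_partialDeriv {φ : Plane → ℂ} (h : ContDiff ℝ ∞ φ) (i : Fin 2) :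
    Continuous (partialDeriv i φ) :=
  (h.continuous_fderiv (by simp)).clm_apply continuous_const

lemma partialDeriv_sub {φ ψ : Plane → ℂ} (hφ : ContDiff ℝ ∞ φ) (hψ : ContDiff ℝ ∞ ψ) (i : Fin 2)
    (x : Plane) : partialDeriv i (fun y => φ y - ψ y) x =
      partialDeriv i φ x - partialDeriv i ψ x := by
  simp only [partialDeriv]
  rw [fderiv_fun_sub (hφ.differentiable (by simp) x) (hψ.differentiable (by simp) x)]
  rfl

/-- The closed polar rectangle is compact and is mapped into `slitDomain`. Adding the origin to the
slit plane is what makes this include the vertex. -/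
lemma exists_bound_planeSector {θm θM R : ℝ} (hθm : -Real.pi < θm) (hθM : θM < Real.pi)
    {h : Plane → ℂ} (hh : ContinuousOn h slitDomain) :
    ∃ C : ℝ, ∀ ρ ∈ Set.Icc 0 R, ∀ θ ∈ Set.Icc θm θM, ‖h (polarPoint ρ θ)‖ ≤ C := by
  have hc : ContinuousOn (fun p : ℝ × ℝ => h (polarPoint p.1 p.2))
      (Set.Icc 0 R ×ˢ Set.Icc θm θM) := by
    refine hh.comp continuous_polarPoint.continuousOn ?_
    rintro ⟨ρ, θ⟩ ⟨h1, h2⟩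
    exact polarPoint_mem_slitDomain h1.1 ⟨hθm.trans_le h2.1, h2.2.trans_lt hθM⟩
  obtain ⟨C, hC⟩ := (isCompact_Icc.prod isCompact_Icc).exists_bound_of_continuousOn hc
  exact ⟨C, fun ρ hρ θ hθ => hC (ρ, θ) ⟨hρ, hθ⟩⟩

lemma ae_bound_planeSector {θm θM R : ℝ} (hθm : -Real.pi < θm) (hθM : θM < Real.pi)
    {h : Plane → ℂ} (hh : ContinuousOn h slitDomain) :
    ∃ C : ℝ, ∀ᵐ x ∂volume.restrict (planeSector θm θM R), ‖h x‖ ≤ C := by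
  obtain ⟨C, hC⟩ := exists_bound_planeSector (R := R) hθm hθM hh
  refine ⟨C, ae_restrict_of_forall_mem (isOpen_planeSector hθM R).measurableSet fun x hx => ?_⟩
  rw [mem_planeSector] at hx
  rw [← polarPoint_norm_arg x]
  exact hC _ ⟨norm_nonneg x, hx.2.le⟩ _ ⟨hx.1.2.1.le, hx.1.2.2.le⟩

lemma aestronglyMeasurable_planeSector {θm θM R : ℝ} (hθM : θM < Real.pi)
    {h : Plane → ℂ} (hh : ContinuousOn h slitDomain) :
    AEStronglyMeasurable h (volume.restrict (planeSector θm θM R)) :=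
  (hh.mono (planeSector_subset_slitDomain hθM)).aestronglyMeasurable
    (isOpen_planeSector hθM R).measurableSet

instance isFiniteMeasure_planeSector (θm θM R : ℝ) :
    IsFiniteMeasure (volume.restrict (planeSector θm θM R)) :=
  ⟨by
    rw [Measure.restrict_apply_univ]
    exact (measure_mono Set.inter_subset_right).trans_lt measure_ball_lt_top⟩

lemma integrable_planeSector {θm θM R : ℝ} (hθm : -Real.pi < θm) (hθM : θM < Real.pi)
    {h : Plane → ℂ} (hh : ContinuousOn h slitDomain) :
    Integrable h (volume.restrict (planeSector θm θM R)) := by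
  obtain ⟨C, hC⟩ := ae_bound_planeSector (R := R) hθm hθM hh
  exact Integrable.of_bound (aestronglyMeasurable_planeSector hθM hh) C hC

lemma integrable_mul_planeSector {θm θM R : ℝ} (hθm : -Real.pi < θm) (hθM : θM < Real.pi)
    {h v : Plane → ℂ} (hh : ContinuousOn h slitDomain)
    (hv : MemLp v 2 (volume.restrict (planeSector θm θM R))) :
    Integrable (fun x => v x * h x) (volume.restrict (planeSector θm θM R)) := by
  obtain ⟨C, hC⟩ := ae_bound_planeSector (R := R) hθm hθM hh
  exact (hv.integrable one_le_two).mul_bdd (aestronglyMeasurable_planeSector hθM hh) hC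

/-- Green's formula on a circular sector for a vector field `v` with divergence `∑ i, d i`,
approximated in `L²` by smooth fields whose normal components on the two sides tend to zero. -/
theorem integral_green_planeSector {θm θM R : ℝ} (hθm : -Real.pi < θm) (hθ : θm < θM)
    (hθM : θM < Real.pi) (hR : 0 < R) {V : Fin 2 → ℕ → Plane → ℂ} {v d : Fin 2 → Plane → ℂ}
    (hV : ∀ i n, ContDiff ℝ ∞ (V i n))
    (hv : ∀ i, MemLp (v i) 2 (volume.restrict (planeSector θm θM R)))
    (hd : ∀ i, MemLp (d i) 2 (volume.restrict (planeSector θm θM R)))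
    (hVv : ∀ i, Tendsto (fun n => eLpNorm (fun x => V i n x - v i x) 2
      (volume.restrict (planeSector θm θM R))) atTop (𝓝 0))
    (hVd : ∀ i, Tendsto (fun n => eLpNorm (fun x => partialDeriv i (V i n) x - d i x) 2
      (volume.restrict (planeSector θm θM R))) atTop (𝓝 0))
    (hbd : ∀ θ, θ = θm ∨ θ = θM → Tendsto (fun n => eLpNorm
      (fun ρ => ∑ i, (rayNormal θ i : ℂ) * V i n (polarPoint ρ θ)) 2
        (volume.restrict (Set.Ioo 0 R))) atTop (𝓝 0))
    {η : Plane → ℂ} {e : Fin 2 → Plane → ℂ}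
    (hη : ContinuousOn η slitDomain) (he : ∀ i, ContinuousOn (e i) slitDomain)
    (hηe : ∀ x, planeToComplex x ∈ Complex.slitPlane →
      HasFDerivAt η (planeForm (e 0 x) (e 1 x)) x)
    (hηR : ∀ x, ‖x‖ = R → η x = 0) :
    ∑ i, ((∫ x in planeSector θm θM R, d i x * η x) +
      ∫ x in planeSector θm θM R, v i x * e i x) = 0 := by
  have hVc : ∀ i n, Continuous (V i n) := fun i n => (hV i n).continuous
  have hdiv : ∀ n, ∑ i, ((∫ x in planeSector θm θM R, partialDeriv i (V i n) x * η x) +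
      ∫ x in planeSector θm θM R, V i n x * e i x) =
      (∫ ρ in Set.Ioo 0 R, (∑ i, (rayNormal θM i : ℂ) * V i n (polarPoint ρ θM)) *
          η (polarPoint ρ θM)) -
        ∫ ρ in Set.Ioo 0 R, (∑ i, (rayNormal θm i : ℂ) * V i n (polarPoint ρ θm)) *
          η (polarPoint ρ θm) := by
    intro n
    -- The divergence theorem is applied to the smooth field `η V n`, before any limit is taken;
    -- only `η` has to vanish on the arc.
    have h := integral_divergence_planeSector hθm hθ hθM hR
      (F := fun i x => V i n x * η x)
      (D := fun i j x => partialDeriv j (V i n) x * η x + V i n x * e j x)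
      (fun i => (hVc i n).continuousOn.mul hη)
      (fun i x hx => ((hasFDerivAt_planeForm ((hV i n).differentiable (by simp) x)).mul
        (hηe x hx)).congr_fderiv (by ext y; simp [planeForm]; ring))
      (fun i => (((hV i n).continuous_partialDeriv i).continuousOn.mul hη).add
        ((hVc i n).continuousOn.mul (he i)))
      (fun i x hx => by rw [hηR x hx, mul_zero])
    rw [integral_finsetSum _ fun i _ => ?_] at h
    · simp only [intervalIntegral.integral_of_le hR.le, integral_Ioc_eq_integral_Ioo] at h
      simp only [Finset.sum_mul, mul_assoc]
      rw [← h]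
      refine Finset.sum_congr rfl fun i _ => ?_
      rw [integral_add]
      · exact integrable_planeSector hθm hθM
          (((hV i n).continuous_partialDeriv i).continuousOn.mul hη)
      · exact integrable_planeSector hθm hθM ((hVc i n).continuousOn.mul (he i))
    · exact integrable_planeSector hθm hθM
        ((((hV i n).continuous_partialDeriv i).continuousOn.mul hη).add
          ((hVc i n).continuousOn.mul (he i)))
  have hlim : Tendsto (fun n => ∑ i,
      ((∫ x in planeSector θm θM R, partialDeriv i (V i n) x * η x) +
        ∫ x in planeSector θm θM R, V i n x * e i x)) atTop
      (𝓝 (∑ i, ((∫ x in planeSector θm θM R, d i x * η x) +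
        ∫ x in planeSector θm θM R, v i x * e i x))) := by
    obtain ⟨C, hC⟩ := ae_bound_planeSector (R := R) hθm hθM hη
    refine tendsto_finsetSum _ fun i _ => Tendsto.add ?_ ?_
    · exact tendsto_integral_mul_of_eLpNorm_two
        (fun n => ((hV i n).continuous_partialDeriv i).aestronglyMeasurable) (hd i) (hVd i)
        (aestronglyMeasurable_planeSector hθM hη) hC
    · obtain ⟨C', hC'⟩ := ae_bound_planeSector (R := R) hθm hθM (he i)
      exact tendsto_integral_mul_of_eLpNorm_two
        (fun n => (hVc i n).aestronglyMeasurable) (hv i) (hVv i)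
        (aestronglyMeasurable_planeSector hθM (he i)) hC'
  have hray : ∀ θ, θ = θm ∨ θ = θM → Tendsto (fun n => ∫ ρ in Set.Ioo 0 R,
      (∑ i, (rayNormal θ i : ℂ) * V i n (polarPoint ρ θ)) * η (polarPoint ρ θ)) atTop (𝓝 0) := by
    intro θ hθ'
    have hmem : θ ∈ Set.Icc θm θM := by
      rcases hθ' with rfl | rfl
      · exact ⟨le_rfl, hθ.le⟩
      · exact ⟨hθ.le, le_rfl⟩
    have hcray : Continuous fun ρ => polarPoint ρ θ := (isometry_polarPoint θ).continuous
    obtain ⟨C, hC⟩ := exists_bound_planeSector (R := R) hθm hθM hη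
    have := tendsto_integral_mul_of_eLpNorm_two (μ := volume.restrict (Set.Ioo 0 R))
      (a := fun n ρ => ∑ i, (rayNormal θ i : ℂ) * V i n (polarPoint ρ θ)) (a' := fun _ => 0)
      (b := fun ρ => η (polarPoint ρ θ)) (C := C)
      (fun n => (continuous_finsetSum _ fun i _ =>
        continuous_const.mul ((hVc i n).comp hcray)).aestronglyMeasurable)
      MemLp.zero' (by simpa using hbd θ hθ')
      (ContinuousOn.aestronglyMeasurable (hη.comp hcray.continuousOn fun ρ hρ =>
        polarPoint_mem_slitDomain hρ.1.le ⟨hθm.trans_le hmem.1, hmem.2.trans_lt hθM⟩)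
        measurableSet_Ioo)
      (ae_restrict_of_forall_mem measurableSet_Ioo fun ρ hρ =>
        hC ρ ⟨hρ.1.le, hρ.2.le⟩ θ hmem)
    simpa using this
  refine tendsto_nhds_unique hlim ?_
  simp only [hdiv]
  simpa using (hray θM (Or.inr rfl)).sub (hray θm (Or.inl rfl))

/-! ### Weak derivatives and approximation of the Cauchy data -/

lemma LocallyIntegrableOn.integrableOn_smul_testFunction {U : Set Plane} {v : Plane → ℂ}
    (hv : LocallyIntegrableOn v U volume) {g : Plane → ℝ} (hg : IsTestFunction U g) :
    IntegrableOn (fun x => g x • v x) U volume := by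
  obtain ⟨h1, h2, h3⟩ := hg
  have h4 : IntegrableOn v (tsupport g) volume := hv.integrableOn_compact_subset h3 h2
  obtain ⟨C, hC⟩ := h2.exists_bound_of_continuous h1.continuous
  have h5 : IntegrableOn (fun x => g x • v x) (tsupport g) volume :=
    h4.bdd_smul C h1.continuous.aestronglyMeasurable (ae_of_all _ hC)
  refine Integrable.integrableOn ((integrableOn_iff_integrable_of_support_subset ?_).1 h5)
  intro x hx
  refine subset_tsupport g fun h => hx ?_
  simp only [h, zero_smul]

/-- The fundamental lemma of the calculus of variations, applied to `v - v'`. It reconciles the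
gradients that the Poisson equation, the traces and the normal derivative each choose independently.
-/
lemma HasWeakPartial.ae_unique {U : Set Plane} (hU : IsOpen U) {i : Fin 2} {u u' v v' : Plane → ℂ}
    (h : HasWeakPartial U i u v) (h' : HasWeakPartial U i u' v')
    (huu : u =ᵐ[volume.restrict U] u') : v =ᵐ[volume.restrict U] v' := by
  have key := hU.ae_eq_zero_of_integral_contDiff_smul_eq_zero (h.2.1.sub h'.2.1) (μ := volume)
    (f := v - v') fun g g1 g2 g3 => ?_
  · rw [EventuallyEq, ae_restrict_iff' hU.measurableSet]
    filter_upwards [key] with x hx hxU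
    exact sub_eq_zero.1 (hx hxU)
  · have hg : IsTestFunction U g := ⟨g1, g2, g3⟩
    rw [← setIntegral_eq_integral_of_forall_compl_eq_zero (s := U) fun x hx => by
      rw [image_eq_zero_of_notMem_tsupport fun hx' => hx (g3 hx'), zero_smul]]
    simp only [Pi.sub_apply, smul_sub]
    rw [integral_sub (LocallyIntegrableOn.integrableOn_smul_testFunction h.2.1 hg)
      (LocallyIntegrableOn.integrableOn_smul_testFunction h'.2.1 hg), sub_eq_zero,
      ← neg_inj, ← h.2.2 g hg, ← h'.2.2 g hg]
    refine integral_congr_ae ?_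
    filter_upwards [huu] with x hx
    rw [hx]

/-- A function with a trace has smooth approximations whose derivatives converge to the weak
derivatives. -/
lemma HasTrace.exists_approx {U Γ : Set Plane} (hU : IsOpen U) {u g : Plane → ℂ}
    (h : HasTrace U Γ u g) :
    MemLp u 2 (volume.restrict U) ∧ AEStronglyMeasurable g (arcMeasure Γ) ∧
      ∃ φ : ℕ → Plane → ℂ, (∀ n, ContDiff ℝ ∞ (φ n)) ∧
        Tendsto (fun n => eLpNorm (fun x => φ n x - u x) 2 (volume.restrict U)) atTop (𝓝 0) ∧
        Tendsto (fun n => eLpNorm (fun x => φ n x - g x) 2 (arcMeasure Γ)) atTop (𝓝 0) ∧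
        ∀ i u₁ v, u =ᵐ[volume.restrict U] u₁ → HasWeakPartial U i u₁ v →
          MemLp v 2 (volume.restrict U) ∧
          Tendsto (fun n => eLpNorm (fun x => partialDeriv i (φ n) x - v x) 2
            (volume.restrict U)) atTop (𝓝 0) := by
  obtain ⟨⟨hu, hu'⟩, hg, φ, hφ, h1, h2, h3⟩ := h
  refine ⟨hu, hg.1, φ, hφ, h1, h3, fun i u₁ v huu hv => ⟨?_, ?_⟩⟩
  · obtain ⟨w, hw, hw'⟩ := hu' i
    exact (memLp_congr_ae (hw.ae_unique hU hv huu)).1 hw'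
  · obtain ⟨w, hw, hw'⟩ := h2 i
    have hae := hw.ae_unique hU hv huu
    refine hw'.congr fun n => eLpNorm_congr_ae ?_
    filter_upwards [hae] with x hx
    rw [hx]

lemma tendsto_eLpNorm_sub_sub {X : Type*} [MeasurableSpace X] {μ : Measure X}
    {a b : ℕ → X → ℂ} {a' b' : X → ℂ}
    (ha : ∀ n, AEStronglyMeasurable (a n) μ) (ha' : AEStronglyMeasurable a' μ)
    (hb : ∀ n, AEStronglyMeasurable (b n) μ) (hb' : AEStronglyMeasurable b' μ)
    (hla : Tendsto (fun n => eLpNorm (fun x => a n x - a' x) 2 μ) atTop (𝓝 0))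
    (hlb : Tendsto (fun n => eLpNorm (fun x => b n x - b' x) 2 μ) atTop (𝓝 0)) :
    Tendsto (fun n => eLpNorm (fun x => (a n x - b n x) - (a' x - b' x)) 2 μ) atTop (𝓝 0) := by
  refine tendsto_of_tendsto_of_tendsto_of_le_of_le tendsto_const_nhds
    (by simpa using hla.add hlb) (fun _ => zero_le) fun n => ?_
  refine le_of_eq_of_le (congrArg (fun F => eLpNorm F 2 μ) ?_)
    (eLpNorm_sub_le ((ha n).sub ha') ((hb n).sub hb') one_le_two)
  ext x
  simp
  ring

lemma tendsto_eLpNorm_ray {Γ : Set Plane} {r θ : ℝ} (h : ∀ ρ ∈ Set.Ioo 0 r, polarPoint ρ θ ∈ Γ)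
    {a : ℕ → Plane → ℂ} {a' : Plane → ℂ} (ha : ∀ n, AEStronglyMeasurable (a n) (arcMeasure Γ))
    (ha' : AEStronglyMeasurable a' (arcMeasure Γ))
    (hl : Tendsto (fun n => eLpNorm (fun x => a n x - a' x) 2 (arcMeasure Γ)) atTop (𝓝 0)) :
    Tendsto (fun n => eLpNorm (fun ρ => a n (polarPoint ρ θ) - a' (polarPoint ρ θ)) 2
      (volume.restrict (Set.Ioo 0 r))) atTop (𝓝 0) :=
  tendsto_of_tendsto_of_tendsto_of_le_of_le tendsto_const_nhds hl (fun _ => zero_le)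
    fun n => eLpNorm_ray_le (G := fun x => a n x - a' x) h ((ha n).sub ha')

/-- Smooth approximations, up to first order, of the difference of two functions with the same
Cauchy data on the sides of a sector and of its gradient. -/
theorem SameCauchyData.exists_approx {θm θM r : ℝ} (hθm : -Real.pi < θm) (hθ : θm < θM)
    (hθM : θM < Real.pi) {Γ : Set Plane}
    (hΓ : ∀ θ, θ = θm ∨ θ = θM → ∀ ρ ∈ Set.Ioo 0 r, polarPoint ρ θ ∈ Γ) {u u' f f' : Plane → ℂ}
    (hΔ : SolvesPoisson (planeSector θm θM r) u f)
    (hΔ' : SolvesPoisson (planeSector θm θM r) u' f')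
    (hC : SameCauchyData (planeSector θm θM r) Γ u u') :
    ∃ (v d : Fin 2 → Plane → ℂ) (Φ : ℕ → Plane → ℂ) (V : Fin 2 → ℕ → Plane → ℂ),
      MemLp (fun x => u x - u' x) 2 (volume.restrict (planeSector θm θM r)) ∧
      (∀ i, MemLp (v i) 2 (volume.restrict (planeSector θm θM r))) ∧
      (∀ i, MemLp (d i) 2 (volume.restrict (planeSector θm θM r))) ∧
      (∀ n, ContDiff ℝ ∞ (Φ n)) ∧ (∀ i n, ContDiff ℝ ∞ (V i n)) ∧
      Tendsto (fun n => eLpNorm (fun x => Φ n x - (u x - u' x)) 2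
        (volume.restrict (planeSector θm θM r))) atTop (𝓝 0) ∧
      (∀ i, Tendsto (fun n => eLpNorm (fun x => partialDeriv i (Φ n) x - v i x) 2
        (volume.restrict (planeSector θm θM r))) atTop (𝓝 0)) ∧
      (∀ i, Tendsto (fun n => eLpNorm (fun x => V i n x - v i x) 2
        (volume.restrict (planeSector θm θM r))) atTop (𝓝 0)) ∧
      (∀ i, Tendsto (fun n => eLpNorm (fun x => partialDeriv i (V i n) x - d i x) 2
        (volume.restrict (planeSector θm θM r))) atTop (𝓝 0)) ∧
      (∀ θ, θ = θm ∨ θ = θM → Tendsto (fun n => eLpNorm (fun ρ => Φ n (polarPoint ρ θ)) 2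
        (volume.restrict (Set.Ioo 0 r))) atTop (𝓝 0)) ∧
      (∀ θ, θ = θm ∨ θ = θM → Tendsto (fun n => eLpNorm
        (fun ρ => ∑ i, (rayNormal θ i : ℂ) * V i n (polarPoint ρ θ)) 2
          (volume.restrict (Set.Ioo 0 r))) atTop (𝓝 0)) ∧
      ∀ᵐ x ∂volume.restrict (planeSector θm θM r), ∑ i, d i x = f x - f' x := by
  have hU := isOpen_planeSector (θm := θm) hθM r
  obtain ⟨v, d, hv, hd, hf⟩ := hΔ
  obtain ⟨v', d', hv', hd', hf'⟩ := hΔ'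
  obtain ⟨⟨g, hg, hg'⟩, h, ⟨w, G, hw, hG, hh⟩, ⟨w', G', hw', hG', hh'⟩⟩ := hC
  -- The gradient `w` carrying the traces and the gradient `v` differentiated in the Poisson
  -- equation are only almost everywhere equal, so approximations of `w` are transferred to `v`.
  have hwv : ∀ i, w i =ᵐ[volume.restrict (planeSector θm θM r)] v i := fun i =>
    (hw i).ae_unique hU (hv i) (ae_eq_refl u)
  have hwv' : ∀ i, w' i =ᵐ[volume.restrict (planeSector θm θM r)] v' i := fun i =>
    (hw' i).ae_unique hU (hv' i) (ae_eq_refl u')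
  obtain ⟨hu2, hgm, φ, hφ, hφu, hφg, hφd⟩ := hg.exists_approx hU
  obtain ⟨hu2', -, φ', hφ', hφu', hφg', hφd'⟩ := hg'.exists_approx hU
  choose hw2 hGm ψ hψ hψw hψG hψd using fun i => (hG i).exists_approx hU
  choose hw2' hGm' ψ' hψ' hψw' hψG' hψd' using fun i => (hG' i).exists_approx hU
  have hv2 : ∀ i, MemLp (v i) 2 (volume.restrict (planeSector θm θM r)) := fun i =>
    (hφd i u (v i) (ae_eq_refl u) (hv i)).1
  have hv2' : ∀ i, MemLp (v' i) 2 (volume.restrict (planeSector θm θM r)) := fun i =>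
    (hφd' i u' (v' i) (ae_eq_refl u') (hv' i)).1
  have hd2 : ∀ i, MemLp (d i) 2 (volume.restrict (planeSector θm θM r)) := fun i =>
    (hψd i i (v i) (d i) (hwv i) (hd i)).1
  have hd2' : ∀ i, MemLp (d' i) 2 (volume.restrict (planeSector θm θM r)) := fun i =>
    (hψd' i i (v' i) (d' i) (hwv' i) (hd' i)).1
  have hψv : ∀ i, Tendsto (fun n => eLpNorm (fun x => ψ i n x - v i x) 2
      (volume.restrict (planeSector θm θM r))) atTop (𝓝 0) := fun i => by
    refine (hψw i).congr fun n => eLpNorm_congr_ae ?_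
    filter_upwards [hwv i] with x hx
    rw [hx]
  have hψv' : ∀ i, Tendsto (fun n => eLpNorm (fun x => ψ' i n x - v' i x) 2
      (volume.restrict (planeSector θm θM r))) atTop (𝓝 0) := fun i => by
    refine (hψw' i).congr fun n => eLpNorm_congr_ae ?_
    filter_upwards [hwv' i] with x hx
    rw [hx]
  have hcs : ∀ {a : Plane → ℂ} {μ : Measure Plane}, ContDiff ℝ ∞ a → AEStronglyMeasurable a μ :=
    fun ha => ha.continuous.aestronglyMeasurable
  have hcd : ∀ {a : Plane → ℂ} {μ : Measure Plane} (i : Fin 2), ContDiff ℝ ∞ a →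
      AEStronglyMeasurable (partialDeriv i a) μ :=
    fun i ha => (ha.continuous_partialDeriv i).aestronglyMeasurable
  refine ⟨fun i x => v i x - v' i x, fun i x => d i x - d' i x, fun n x => φ n x - φ' n x,
    fun i n x => ψ i n x - ψ' i n x, hu2.sub hu2', fun i => (hv2 i).sub (hv2' i),
    fun i => (hd2 i).sub (hd2' i), fun n => (hφ n).sub (hφ' n),
    fun i n => (hψ i n).sub (hψ' i n), ?_, fun i => ?_, fun i => ?_, fun i => ?_,
    fun θ hθ' => ?_, fun θ hθ' => ?_, ?_⟩
  · exact tendsto_eLpNorm_sub_sub (fun n => hcs (hφ n)) hu2.1 (fun n => hcs (hφ' n)) hu2'.1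
      hφu hφu'
  · simp only [partialDeriv_sub (hφ _) (hφ' _)]
    exact tendsto_eLpNorm_sub_sub (fun n => hcd i (hφ n)) (hv2 i).1 (fun n => hcd i (hφ' n))
      (hv2' i).1 (hφd i u (v i) (ae_eq_refl u) (hv i)).2
      (hφd' i u' (v' i) (ae_eq_refl u') (hv' i)).2
  · exact tendsto_eLpNorm_sub_sub (fun n => hcs (hψ i n)) (hv2 i).1 (fun n => hcs (hψ' i n))
      (hv2' i).1 (hψv i) (hψv' i)
  · simp only [partialDeriv_sub (hψ i _) (hψ' i _)]
    exact tendsto_eLpNorm_sub_sub (fun n => hcd i (hψ i n)) (hd2 i).1 (fun n => hcd i (hψ' i n))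
      (hd2' i).1 (hψd i i (v i) (d i) (hwv i) (hd i)).2
      (hψd' i i (v' i) (d' i) (hwv' i) (hd' i)).2
  · have := tendsto_eLpNorm_ray (hΓ θ hθ') (fun n => (hcs (hφ n)).sub (hcs (hφ' n)))
      (hgm.sub hgm) (tendsto_eLpNorm_sub_sub (fun n => hcs (hφ n)) hgm (fun n => hcs (hφ' n))
        hgm hφg hφg')
    simpa using this
  -- The components `G i - G' i` need not vanish separately on a side; only their normal combination
  -- does. So the limits are kept in each component and cancelled after summation.
  · have hterm : ∀ i, Tendsto (fun n => eLpNorm (fun ρ => (rayNormal θ i : ℂ) *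
        ((ψ i n (polarPoint ρ θ) - ψ' i n (polarPoint ρ θ)) -
          (G i (polarPoint ρ θ) - G' i (polarPoint ρ θ)))) 2
        (volume.restrict (Set.Ioo 0 r))) atTop (𝓝 0) := fun i => by
      have := tendsto_eLpNorm_ray (hΓ θ hθ') (fun n => (hcs (hψ i n)).sub (hcs (hψ' i n)))
        ((hGm i).sub (hGm' i)) (tendsto_eLpNorm_sub_sub (fun n => hcs (hψ i n)) (hGm i)
          (fun n => hcs (hψ' i n)) (hGm' i) (hψG i) (hψG' i))
      have h2 := ENNReal.Tendsto.const_mul (a := ‖(rayNormal θ i : ℂ)‖ₑ) this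
        (Or.inr enorm_ne_top)
      rw [mul_zero] at h2
      refine h2.congr fun n => ?_
      rw [← eLpNorm_const_smul]
      rfl
    have hnormal : ∀ᵐ ρ ∂volume.restrict (Set.Ioo 0 r),
        ∑ i, (rayNormal θ i : ℂ) * (G i (polarPoint ρ θ) - G' i (polarPoint ρ θ)) = 0 := by
      filter_upwards [ae_ray_of_ae_arcMeasure (hΓ θ hθ') hh, ae_ray_of_ae_arcMeasure (hΓ θ hθ') hh',
        ae_restrict_mem measurableSet_Ioo] with ρ h1 h2 hρ
      rcases hθ' with rfl | rfl
      -- On the lower side the outward normal is `-rayNormal θm`, hence the sign below.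
      · have hn := isOutwardUnitNormal_lower_ray hθm hθ hθM hρ.1 hρ.2
        have := (h1 _ hn).symm.trans (h2 _ hn)
        simp only [Fin.sum_univ_two, PiLp.neg_apply, Complex.ofReal_neg] at this ⊢
        linear_combination -this
      · have hn := isOutwardUnitNormal_upper_ray hθm hθ hθM hρ.1 hρ.2
        have := (h1 _ hn).symm.trans (h2 _ hn)
        simp only [Fin.sum_univ_two] at this ⊢
        linear_combination this
    have hm : ∀ i n, AEStronglyMeasurable (fun ρ => (rayNormal θ i : ℂ) *
        ((ψ i n (polarPoint ρ θ) - ψ' i n (polarPoint ρ θ)) -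
          (G i (polarPoint ρ θ) - G' i (polarPoint ρ θ)))) (volume.restrict (Set.Ioo 0 r)) := by
      intro i n
      have := ((((hcs (hψ i n)).sub (hcs (hψ' i n))).sub ((hGm i).sub (hGm' i))).mono_measure
        (map_polarPoint_le_arcMeasure (hΓ θ hθ'))).comp_measurable
          (isometry_polarPoint θ).continuous.measurable
      exact this.const_mul _
    refine tendsto_of_tendsto_of_tendsto_of_le_of_le tendsto_const_nhds
      (by have := (hterm 0).add (hterm 1); rwa [add_zero] at this) (fun _ => zero_le) fun n => ?_
    refine le_of_eq_of_le (eLpNorm_congr_ae ?_) (eLpNorm_add_le (hm 0 n) (hm 1 n) one_le_two)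
    filter_upwards [hnormal] with ρ hρ
    simp only [Fin.sum_univ_two, Pi.add_apply] at hρ ⊢
    linear_combination hρ
  · filter_upwards [hf, hf'] with x h1 h2
    rw [← h1, ← h2, Finset.sum_sub_distrib]

/-! ### Cut-off powers of `z` as test functions -/

lemma hasFDerivAt_planeToComplex (x : Plane) :
    HasFDerivAt planeToComplex (planeForm 1 Complex.I) x := by
  refine planeToComplex.toContinuousLinearEquiv.hasFDerivAt.congr_fderiv ?_
  ext y
  change planeToComplex y = _
  rw [planeToComplex_apply]
  apply Complex.ext <;> simp [planeForm]

/-- Pulling out `z ^ (s - 1)` keeps the partial derivatives in the form "smooth factor times a power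
of `z`", so the lemma can be applied twice to obtain second derivatives. -/
lemma hasFDerivAt_mul_cpow {p : Plane → ℂ} {p0 p1 : ℂ} {x : Plane}
    (hp : HasFDerivAt p (planeForm p0 p1) x) (hx : planeToComplex x ∈ Complex.slitPlane) (s : ℂ) :
    HasFDerivAt (fun y => p y * planeToComplex y ^ s)
      (planeForm ((planeToComplex x * p0 + s * p x) * planeToComplex x ^ (s - 1))
        ((planeToComplex x * p1 + s * Complex.I * p x) * planeToComplex x ^ (s - 1))) x := by
  have h1 : HasFDerivAt (fun y => planeToComplex y ^ s) _ x :=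
    (Complex.hasStrictDerivAt_cpow_const hx).hasDerivAt.comp_hasFDerivAt x
      (hasFDerivAt_planeToComplex x)
  have h2 : planeToComplex x ^ s = planeToComplex x * planeToComplex x ^ (s - 1) := by
    rw [Complex.cpow_sub _ _ (Complex.slitPlane_ne_zero hx), Complex.cpow_one,
      mul_div_cancel₀ _ (Complex.slitPlane_ne_zero hx)]
  refine (hp.mul h1).congr_fderiv ?_
  ext y
  simp [planeForm, h2]
  ring

lemma continuousOn_mul_cpow {p : Plane → ℂ} (hp : Continuous p) {s : ℂ} (hs : 0 < s.re) :
    ContinuousOn (fun x => p x * planeToComplex x ^ s) slitDomain := by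
  intro x hx
  have : ContinuousAt (fun z : ℂ => z ^ s) (planeToComplex x) := by
    refine Complex.continuousAt_cpow_const_of_re_pos ?_ hs
    rcases hx with hx | hx
    · left
      rw [hx, Complex.zero_re]
    · exact hx.imp le_of_lt id
  exact (hp.continuousAt.mul (ContinuousAt.comp (g := fun z : ℂ => z ^ s) this
    planeToComplex.continuous.continuousAt)).continuousWithinAt

/-- Green's formula on a circular sector for the `i`-th partial derivative of a function with zero
trace on the sides. -/
theorem integral_green_partial_planeSector {θm θM R : ℝ} (hθm : -Real.pi < θm) (hθ : θm < θM)
    (hθM : θM < Real.pi) (hR : 0 < R) (i : Fin 2) {Φ : ℕ → Plane → ℂ} {w v : Plane → ℂ}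
    (hΦ : ∀ n, ContDiff ℝ ∞ (Φ n))
    (hw : MemLp w 2 (volume.restrict (planeSector θm θM R)))
    (hv : MemLp v 2 (volume.restrict (planeSector θm θM R)))
    (hΦw : Tendsto (fun n => eLpNorm (fun x => Φ n x - w x) 2
      (volume.restrict (planeSector θm θM R))) atTop (𝓝 0))
    (hΦv : Tendsto (fun n => eLpNorm (fun x => partialDeriv i (Φ n) x - v x) 2
      (volume.restrict (planeSector θm θM R))) atTop (𝓝 0))
    (hbd : ∀ θ, θ = θm ∨ θ = θM → Tendsto (fun n => eLpNorm
      (fun ρ => Φ n (polarPoint ρ θ)) 2 (volume.restrict (Set.Ioo 0 R))) atTop (𝓝 0))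
    {η : Plane → ℂ} {e : Fin 2 → Plane → ℂ}
    (hη : ContinuousOn η slitDomain) (he : ∀ i, ContinuousOn (e i) slitDomain)
    (hηe : ∀ x, planeToComplex x ∈ Complex.slitPlane →
      HasFDerivAt η (planeForm (e 0 x) (e 1 x)) x)
    (hηR : ∀ x, ‖x‖ = R → η x = 0) :
    (∫ x in planeSector θm θM R, v x * η x) + ∫ x in planeSector θm θM R, w x * e i x = 0 := by
  have hpd : ∀ j x, partialDeriv j (fun _ : Plane => (0 : ℂ)) x = 0 := fun j x => by
    simp [partialDeriv]
  -- Green's formula for the vector field whose only nonzero component is the `i`-th, equal to `Φ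
  -- n`.
  have h := integral_green_planeSector hθm hθ hθM hR
    (V := fun j n => if j = i then Φ n else fun _ => 0) (v := fun j => if j = i then w else fun _ => 0)
    (d := fun j => if j = i then v else fun _ => 0)
    (fun j n => by
      by_cases hj : j = i
      · simpa [hj] using hΦ n
      · simpa [hj] using contDiff_const)
    (fun j => by
      by_cases hj : j = i
      · simpa [hj] using hw
      · simp [hj])
    (fun j => by
      by_cases hj : j = i
      · simpa [hj] using hv
      · simp [hj])
    (fun j => by
      by_cases hj : j = i
      · simpa [hj] using hΦw
      · simp [hj])
    (fun j => by
      by_cases hj : j = i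
      · simpa [hj] using hΦv
      · simp [hj, hpd])
    (fun θ hθ' => by
      have h2 := ENNReal.Tendsto.const_mul (a := ‖(rayNormal θ i : ℂ)‖ₑ) (hbd θ hθ')
        (Or.inr enorm_ne_top)
      rw [mul_zero] at h2
      refine h2.congr fun n => ?_
      rw [← eLpNorm_const_smul]
      congr 1
      ext ρ
      rw [Finset.sum_eq_single i (fun j _ hj => by simp [hj]) (by simp)]
      simp)
    hη he hηe hηR
  rw [Finset.sum_eq_single i (fun j _ hj => by simp [hj]) (by simp)] at h
  simpa using h

/-- The squared norm on the plane, as a complex number. -/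
noncomputable def planeNormSq (x : Plane) : ℂ := (x 0 : ℂ) ^ 2 + (x 1 : ℂ) ^ 2

lemma planeNormSq_eq (x : Plane) : planeNormSq x = ((‖x‖ ^ 2 : ℝ) : ℂ) := by
  rw [EuclideanSpace.norm_sq_eq]
  simp [planeNormSq, Fin.sum_univ_two]

lemma hasFDerivAt_coord_zero (x : Plane) :
    HasFDerivAt (fun y : Plane => (y 0 : ℂ)) (planeForm 1 0) x :=
  (Complex.ofRealCLM.hasFDerivAt.comp x
    (EuclideanSpace.proj 0 : Plane →L[ℝ] ℝ).hasFDerivAt).congr_fderiv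
      (by ext y; simp [planeForm])

lemma hasFDerivAt_coord_one (x : Plane) :
    HasFDerivAt (fun y : Plane => (y 1 : ℂ)) (planeForm 0 1) x :=
  (Complex.ofRealCLM.hasFDerivAt.comp x
    (EuclideanSpace.proj 1 : Plane →L[ℝ] ℝ).hasFDerivAt).congr_fderiv
      (by ext y; simp [planeForm])

lemma hasFDerivAt_planeNormSq (x : Plane) :
    HasFDerivAt planeNormSq (planeForm (2 * x 0) (2 * x 1)) x :=
  (((hasFDerivAt_coord_zero x).pow 2).add ((hasFDerivAt_coord_one x).pow 2)).congr_fderiv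
    (by ext y; simp [planeForm]; ring)

lemma continuous_planeNormSq : Continuous planeNormSq := by
  unfold planeNormSq
  fun_prop

/-- A radial cutoff vanishing to second order on the circle of radius `R`. -/
noncomputable def radialCutoff (R : ℝ) (x : Plane) : ℂ := ((R : ℂ) ^ 4 - planeNormSq x ^ 2) ^ 2

/-- The radial factor of the gradient of `radialCutoff`. -/
noncomputable def radialCutoffGrad (R : ℝ) (x : Plane) : ℂ :=
  -8 * ((R : ℂ) ^ 4 - planeNormSq x ^ 2) * planeNormSq x

lemma continuous_radialCutoff (R : ℝ) : Continuous (radialCutoff R) :=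
  (continuous_const.sub (continuous_planeNormSq.pow 2)).pow 2

lemma continuous_radialCutoffGrad (R : ℝ) : Continuous (radialCutoffGrad R) :=
  (continuous_const.mul (continuous_const.sub (continuous_planeNormSq.pow 2))).mul
    continuous_planeNormSq

lemma hasFDerivAt_radialCutoff (R : ℝ) (x : Plane) : HasFDerivAt (radialCutoff R)
    (planeForm (radialCutoffGrad R x * x 0) (radialCutoffGrad R x * x 1)) x :=
  ((((hasFDerivAt_planeNormSq x).pow 2).const_sub ((R : ℂ) ^ 4)).pow 2).congr_fderiv
    (by ext y; simp [planeForm, radialCutoffGrad]; ring)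

lemma hasFDerivAt_radialCutoffGrad (R : ℝ) (x : Plane) : HasFDerivAt (radialCutoffGrad R)
    (planeForm (-16 * ((R : ℂ) ^ 4 - 3 * planeNormSq x ^ 2) * x 0)
      (-16 * ((R : ℂ) ^ 4 - 3 * planeNormSq x ^ 2) * x 1)) x :=
  (((((hasFDerivAt_planeNormSq x).pow 2).const_sub ((R : ℂ) ^ 4)).const_mul (-8)).mul
    (hasFDerivAt_planeNormSq x)).congr_fderiv
    (by ext y; simp [planeForm]; ring)

lemma planeToComplex_eq (x : Plane) : planeToComplex x = x 0 + x 1 * Complex.I := by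
  rw [planeToComplex_apply]
  apply Complex.ext <;> simp

lemma continuous_coord (i : Fin 2) : Continuous fun x : Plane => (x i : ℂ) := by fun_prop

lemma planeNormSq_of_norm_eq {R : ℝ} {x : Plane} (h : ‖x‖ = R) : planeNormSq x = (R : ℂ) ^ 2 := by
  rw [planeNormSq_eq, h]
  push_cast
  rfl

lemma radialCutoff_of_norm_eq {R : ℝ} {x : Plane} (h : ‖x‖ = R) : radialCutoff R x = 0 := by
  rw [radialCutoff, planeNormSq_of_norm_eq h]
  ring

lemma radialCutoffGrad_of_norm_eq {R : ℝ} {x : Plane} (h : ‖x‖ = R) :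
    radialCutoffGrad R x = 0 := by
  rw [radialCutoffGrad, planeNormSq_of_norm_eq h]
  ring

/-- The polynomial factor of the Laplacian of `radialCutoff R x * z ^ s`. -/
noncomputable def cutoffLaplacian (R : ℝ) (s : ℂ) (x : Plane) : ℂ :=
  -16 * planeNormSq x * (s * ((R : ℂ) ^ 4 - planeNormSq x ^ 2) +
    2 * ((R : ℂ) ^ 4 - 2 * planeNormSq x ^ 2))

/-- Pairing a function with zero Cauchy data on the sides of a sector against a power of `z`. -/
theorem integral_laplacian_mul_cpow {θm θM R : ℝ} (hθm : -Real.pi < θm) (hθ : θm < θM)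
    (hθM : θM < Real.pi) (hR : 0 < R) {w : Plane → ℂ} {v d : Fin 2 → Plane → ℂ}
    {Φ : ℕ → Plane → ℂ} {V : Fin 2 → ℕ → Plane → ℂ}
    (hw : MemLp w 2 (volume.restrict (planeSector θm θM R)))
    (hv : ∀ i, MemLp (v i) 2 (volume.restrict (planeSector θm θM R)))
    (hd : ∀ i, MemLp (d i) 2 (volume.restrict (planeSector θm θM R)))
    (hΦ : ∀ n, ContDiff ℝ ∞ (Φ n)) (hV : ∀ i n, ContDiff ℝ ∞ (V i n))
    (hΦw : Tendsto (fun n => eLpNorm (fun x => Φ n x - w x) 2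
      (volume.restrict (planeSector θm θM R))) atTop (𝓝 0))
    (hΦv : ∀ i, Tendsto (fun n => eLpNorm (fun x => partialDeriv i (Φ n) x - v i x) 2
      (volume.restrict (planeSector θm θM R))) atTop (𝓝 0))
    (hVv : ∀ i, Tendsto (fun n => eLpNorm (fun x => V i n x - v i x) 2
      (volume.restrict (planeSector θm θM R))) atTop (𝓝 0))
    (hVd : ∀ i, Tendsto (fun n => eLpNorm (fun x => partialDeriv i (V i n) x - d i x) 2
      (volume.restrict (planeSector θm θM R))) atTop (𝓝 0))
    (hbΦ : ∀ θ, θ = θm ∨ θ = θM → Tendsto (fun n => eLpNorm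
      (fun ρ => Φ n (polarPoint ρ θ)) 2 (volume.restrict (Set.Ioo 0 R))) atTop (𝓝 0))
    (hbV : ∀ θ, θ = θm ∨ θ = θM → Tendsto (fun n => eLpNorm
      (fun ρ => ∑ i, (rayNormal θ i : ℂ) * V i n (polarPoint ρ θ)) 2
        (volume.restrict (Set.Ioo 0 R))) atTop (𝓝 0))
    {s : ℂ} (hs : 2 < s.re) :
    ∫ x in planeSector θm θM R, (∑ i, d i x) * (radialCutoff R x * planeToComplex x ^ s) =
      ∫ x in planeSector θm θM R, w x * (cutoffLaplacian R s x * planeToComplex x ^ s) := by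
  -- The two integrations by parts involve `z ^ s`, `z ^ (s - 1)` and `z ^ (s - 2)`; the assumption
  -- `2 < s.re` makes all three continuous at the vertex.
  have hs1 : 0 < (s - 1).re := by rw [Complex.sub_re, Complex.one_re]; linarith
  have hs2 : 0 < (s - 1 - 1).re := by
    rw [Complex.sub_re, Complex.sub_re, Complex.one_re]; linarith
  have hz : Continuous fun x => planeToComplex x := planeToComplex.continuous
  have hc := continuous_radialCutoff R
  have hg := continuous_radialCutoffGrad R
  have hN := continuous_planeNormSq
  have hX := continuous_coord
  set q0 : Plane → ℂ := fun x => planeToComplex x * (radialCutoffGrad R x * x 0) +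
    s * radialCutoff R x with hq0
  set q1 : Plane → ℂ := fun x => planeToComplex x * (radialCutoffGrad R x * x 1) +
    s * Complex.I * radialCutoff R x with hq1
  have hq0c : Continuous q0 := (hz.mul (hg.mul (hX 0))).add (continuous_const.mul hc)
  have hq1c : Continuous q1 := (hz.mul (hg.mul (hX 1))).add (continuous_const.mul hc)
  set k : Plane → ℂ := fun x => -16 * ((R : ℂ) ^ 4 - 3 * planeNormSq x ^ 2) with hk
  have hkc : Continuous k := continuous_const.mul
    (continuous_const.sub (continuous_const.mul (hN.pow 2)))
  set q00 : Plane → ℂ := fun x => radialCutoffGrad R x * x 0 +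
    planeToComplex x * (k x * x 0 * x 0 + radialCutoffGrad R x) +
      s * (radialCutoffGrad R x * x 0) with hq00
  set q01 : Plane → ℂ := fun x => Complex.I * (radialCutoffGrad R x * x 0) +
    planeToComplex x * (k x * x 1 * x 0) + s * (radialCutoffGrad R x * x 1) with hq01
  set q10 : Plane → ℂ := fun x => radialCutoffGrad R x * x 1 +
    planeToComplex x * (k x * x 0 * x 1) + s * Complex.I * (radialCutoffGrad R x * x 0) with hq10
  set q11 : Plane → ℂ := fun x => Complex.I * (radialCutoffGrad R x * x 1) +
    planeToComplex x * (k x * x 1 * x 1 + radialCutoffGrad R x) +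
      s * Complex.I * (radialCutoffGrad R x * x 1) with hq11
  have hgX : ∀ i, Continuous fun x : Plane => radialCutoffGrad R x * x i := fun i => hg.mul (hX i)
  have hkX : ∀ i j, Continuous fun x : Plane => k x * x i * x j :=
    fun i j => (hkc.mul (hX i)).mul (hX j)
  have hq00c : Continuous q00 :=
    ((hgX 0).add (hz.mul ((hkX 0 0).add hg))).add (continuous_const.mul (hgX 0))
  have hq01c : Continuous q01 :=
    ((continuous_const.mul (hgX 0)).add (hz.mul (hkX 1 0))).add (continuous_const.mul (hgX 1))
  have hq10c : Continuous q10 :=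
    ((hgX 1).add (hz.mul (hkX 0 1))).add (continuous_const.mul (hgX 0))
  have hq11c : Continuous q11 :=
    ((continuous_const.mul (hgX 1)).add (hz.mul ((hkX 1 1).add hg))).add
      (continuous_const.mul (hgX 1))
  have hq0d : ∀ x, HasFDerivAt q0 (planeForm (q00 x) (q01 x)) x := fun x =>
    (((hasFDerivAt_planeToComplex x).mul ((hasFDerivAt_radialCutoffGrad R x).mul
      (hasFDerivAt_coord_zero x))).add ((hasFDerivAt_radialCutoff R x).const_mul s)).congr_fderiv
        (by ext y; simp [planeForm, hq00, hq01, hk]; ring)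
  have hq1d : ∀ x, HasFDerivAt q1 (planeForm (q10 x) (q11 x)) x := fun x =>
    (((hasFDerivAt_planeToComplex x).mul ((hasFDerivAt_radialCutoffGrad R x).mul
      (hasFDerivAt_coord_one x))).add
        ((hasFDerivAt_radialCutoff R x).const_mul (s * Complex.I))).congr_fderiv
        (by ext y; simp [planeForm, hq10, hq11, hk]; ring)
  -- First integration by parts: the field is `∇w`, approximated by `V`, with zero normal trace.
  have hgreen := integral_green_planeSector hθm hθ hθM hR hV hv hd hVv hVd hbV
    (η := fun x => radialCutoff R x * planeToComplex x ^ s)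
    (e := ![fun x => q0 x * planeToComplex x ^ (s - 1), fun x => q1 x * planeToComplex x ^ (s - 1)])
    (continuousOn_mul_cpow hc (by linarith))
    (fun i => by
      fin_cases i
      · exact continuousOn_mul_cpow hq0c hs1
      · exact continuousOn_mul_cpow hq1c hs1)
    (fun x hx => hasFDerivAt_mul_cpow (hasFDerivAt_radialCutoff R x) hx s)
    (fun x hx => by rw [radialCutoff_of_norm_eq hx, zero_mul])
  -- Second integration by parts, one component at a time: `w` itself, approximated by `Φ`, with
  -- zero trace. The test functions are the components of `∇(χ z ^ s)`, which vanish on the arc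
  -- because `χ` has a double zero there.
  have hpart0 := integral_green_partial_planeSector hθm hθ hθM hR 0 hΦ hw (hv 0) hΦw (hΦv 0) hbΦ
    (η := fun x => q0 x * planeToComplex x ^ (s - 1))
    (e := ![fun x => (planeToComplex x * q00 x + (s - 1) * q0 x) * planeToComplex x ^ (s - 1 - 1),
      fun x => (planeToComplex x * q01 x + (s - 1) * Complex.I * q0 x) *
        planeToComplex x ^ (s - 1 - 1)])
    (continuousOn_mul_cpow hq0c hs1)
    (fun i => by
      fin_cases i
      · exact continuousOn_mul_cpow ((hz.mul hq00c).add (continuous_const.mul hq0c)) hs2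
      · exact continuousOn_mul_cpow ((hz.mul hq01c).add (continuous_const.mul hq0c)) hs2)
    (fun x hx => hasFDerivAt_mul_cpow (hq0d x) hx (s - 1))
    (fun x hx => by
      simp [hq0, radialCutoff_of_norm_eq hx, radialCutoffGrad_of_norm_eq hx])
  have hpart1 := integral_green_partial_planeSector hθm hθ hθM hR 1 hΦ hw (hv 1) hΦw (hΦv 1) hbΦ
    (η := fun x => q1 x * planeToComplex x ^ (s - 1))
    (e := ![fun x => (planeToComplex x * q10 x + (s - 1) * q1 x) * planeToComplex x ^ (s - 1 - 1),
      fun x => (planeToComplex x * q11 x + (s - 1) * Complex.I * q1 x) *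
        planeToComplex x ^ (s - 1 - 1)])
    (continuousOn_mul_cpow hq1c hs1)
    (fun i => by
      fin_cases i
      · exact continuousOn_mul_cpow ((hz.mul hq10c).add (continuous_const.mul hq1c)) hs2
      · exact continuousOn_mul_cpow ((hz.mul hq11c).add (continuous_const.mul hq1c)) hs2)
    (fun x hx => hasFDerivAt_mul_cpow (hq1d x) hx (s - 1))
    (fun x hx => by
      simp [hq1, radialCutoff_of_norm_eq hx, radialCutoffGrad_of_norm_eq hx])
  have hL : ∫ x in planeSector θm θM R, (∑ i, d i x) * (radialCutoff R x * planeToComplex x ^ s) =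
      (∫ x in planeSector θm θM R, d 0 x * (radialCutoff R x * planeToComplex x ^ s)) +
        ∫ x in planeSector θm θM R, d 1 x * (radialCutoff R x * planeToComplex x ^ s) := by
    simp only [Fin.sum_univ_two, add_mul]
    have hcs := continuousOn_mul_cpow hc (s := s) (by linarith)
    exact integral_add (integrable_mul_planeSector hθm hθM hcs (hd 0))
      (integrable_mul_planeSector hθm hθM hcs (hd 1))
  have hRR : ∫ x in planeSector θm θM R, w x * (cutoffLaplacian R s x * planeToComplex x ^ s) =
      (∫ x in planeSector θm θM R, w x * ((planeToComplex x * q00 x + (s - 1) * q0 x) *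
        planeToComplex x ^ (s - 1 - 1))) +
      ∫ x in planeSector θm θM R, w x * ((planeToComplex x * q11 x +
        (s - 1) * Complex.I * q1 x) * planeToComplex x ^ (s - 1 - 1)) := by
    have hi0 := integrable_mul_planeSector (R := R) hθm hθM (continuousOn_mul_cpow
      (p := fun x => planeToComplex x * q00 x + (s - 1) * q0 x)
      ((hz.mul hq00c).add (continuous_const.mul hq0c)) hs2) hw
    have hi1 := integrable_mul_planeSector (R := R) hθm hθM (continuousOn_mul_cpow
      (p := fun x => planeToComplex x * q11 x + (s - 1) * Complex.I * q1 x)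
      ((hz.mul hq11c).add (continuous_const.mul hq1c)) hs2) hw
    rw [← integral_add hi0 hi1]
    refine setIntegral_congr_fun (isOpen_planeSector hθM R).measurableSet fun x hx => ?_
    have hz0 := Complex.slitPlane_ne_zero (slitPlane_of_mem_planeSector hθM hx)
    have hpow : planeToComplex x ^ s = planeToComplex x ^ 2 * planeToComplex x ^ (s - 1 - 1) := by
      rw [Complex.cpow_sub _ _ hz0, Complex.cpow_sub _ _ hz0, Complex.cpow_one]
      field_simp
    have hpoly : planeToComplex x * q00 x + (s - 1) * q0 x + (planeToComplex x * q11 x +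
        (s - 1) * Complex.I * q1 x) = cutoffLaplacian R s x * planeToComplex x ^ 2 := by
      simp only [hq00, hq0, hq11, hq1, hk, cutoffLaplacian]
      have hz' := planeToComplex_eq x
      have hN' : planeNormSq x = (x 0 : ℂ) ^ 2 + (x 1 : ℂ) ^ 2 := rfl
      have hG : radialCutoffGrad R x = -8 * ((R : ℂ) ^ 4 - planeNormSq x ^ 2) * planeNormSq x := rfl
      -- The relation `I² = -1` removes the term in `s (s - 1) χ`, which is the harmonicity of `z ^
      -- s`; `x₁ + i x₂ = z` and `x₁² + x₂² = |x|²` simplify the rest.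
      linear_combination (-2 * s * planeToComplex x * radialCutoffGrad R x) * hz' -
        planeToComplex x ^ 2 * (-16 * ((R : ℂ) ^ 4 - 3 * planeNormSq x ^ 2)) * hN' +
        (s - 1) * s * radialCutoff R x * Complex.I_sq +
        planeToComplex x ^ 2 * (2 * s + 2) * hG
    simp only [hpow]
    linear_combination (-(w x) * planeToComplex x ^ (s - 1 - 1)) * hpoly
  simp only [Fin.sum_univ_two, Matrix.cons_val_zero, Matrix.cons_val_one] at hgreen hpart0 hpart1
  rw [hL, hRR]
  linear_combination hgreen - hpart0 - hpart1

/-! ### Integrals of powers and holomorphy in the exponent -/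

lemma integrable_norm_rpow_planeSector {θm θM R σ : ℝ} (hR : 0 < R) (hσ : -2 < σ) :
    Integrable (fun x : Plane => ‖x‖ ^ σ) (volume.restrict (planeSector θm θM R)) := by
  refine IntegrableOn.mono_set (t := Metric.ball 0 R) ?_ Set.inter_subset_right
  rw [integrableOn_fun_norm_addHaar volume (f := fun t => t ^ σ)]
  have h : IntegrableOn (fun t : ℝ => t ^ (1 + σ)) (Set.Ioo 0 R) :=
    (intervalIntegral.integrableOn_Ioo_rpow_iff hR).2 (by linarith)
  refine h.congr_fun (fun t ht => ?_) measurableSet_Ioo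
  simp [Real.rpow_add ht.1]

lemma ae_mem_planeSector {θm θM R : ℝ} (hθM : θM < Real.pi) :
    ∀ᵐ x ∂volume.restrict (planeSector θm θM R), x ∈ planeSector θm θM R :=
  ae_restrict_mem (isOpen_planeSector hθM R).measurableSet

lemma aestronglyMeasurable_norm_rpow (σ : ℝ) {μ : Measure Plane} :
    AEStronglyMeasurable (fun x : Plane => ‖x‖ ^ σ) μ :=
  (measurable_norm.pow_const σ).aestronglyMeasurable

lemma integrable_norm_mul_rpow_of_le {θm θM R : ℝ} (hθM : θM < Real.pi) (hR : 0 < R)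
    {h : Plane → ℂ} (hm : AEStronglyMeasurable h (volume.restrict (planeSector θm θM R)))
    {C β σ : ℝ} (hC : ∀ᵐ x ∂volume.restrict (planeSector θm θM R), ‖h x‖ ≤ C * ‖x‖ ^ β)
    (hσ : -2 < β + σ) :
    Integrable (fun x => ‖h x‖ * ‖x‖ ^ σ) (volume.restrict (planeSector θm θM R)) := by
  refine ((integrable_norm_rpow_planeSector hR hσ).const_mul C).mono'
    (hm.norm.mul (aestronglyMeasurable_norm_rpow σ)) ?_
  filter_upwards [hC, ae_mem_planeSector hθM] with x hx hxD
  have h0 : 0 < ‖x‖ := norm_pos_iff.2 (mem_planeSector.1 hxD).1.1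
  rw [Real.norm_of_nonneg (by positivity), Real.rpow_add h0, ← mul_assoc]
  gcongr

/-- For complex `s` the modulus is `|x| ^ Re s * exp (-arg z * Im s)`, and the argument is at most
`π` in absolute value. -/
lemma norm_cpow_planeToComplex_le {x : Plane} (hx : x ≠ 0) (s : ℂ) :
    ‖planeToComplex x ^ s‖ ≤ ‖x‖ ^ s.re * Real.exp (Real.pi * |s.im|) := by
  have hz : planeToComplex x ≠ 0 := by simpa using hx
  rw [Complex.norm_cpow_of_ne_zero hz, LinearIsometryEquiv.norm_map, div_eq_mul_inv,
    ← Real.exp_neg]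
  gcongr
  refine (neg_le_abs _).trans ?_
  rw [abs_mul]
  gcongr
  exact Complex.abs_arg_le_pi _

lemma norm_cpow_planeToComplex_real {x : Plane} (hx : x ≠ 0) (s : ℝ) :
    ‖planeToComplex x ^ (s : ℂ)‖ = ‖x‖ ^ s := by
  have hz : planeToComplex x ≠ 0 := by simpa using hx
  rw [Complex.norm_cpow_of_ne_zero hz, LinearIsometryEquiv.norm_map]
  simp

lemma norm_log_planeToComplex_mul_rpow_le {x : Plane} (hx : x ≠ 0) (hx1 : ‖x‖ ≤ 1) {δ : ℝ}
    (hδ : 0 < δ) : ‖Complex.log (planeToComplex x)‖ * ‖x‖ ^ δ ≤ 1 / δ + Real.pi := by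
  have h0 : 0 < ‖x‖ := norm_pos_iff.2 hx
  have h1 : ‖Complex.log (planeToComplex x)‖ ≤ |Real.log ‖x‖| + Real.pi := by
    refine (Complex.norm_le_abs_re_add_abs_im _).trans ?_
    rw [Complex.log_re, Complex.log_im, LinearIsometryEquiv.norm_map]
    gcongr
    exact Complex.abs_arg_le_pi _
  have h2 := (Real.abs_log_mul_self_rpow_lt ‖x‖ δ h0 hx1 hδ).le
  rw [abs_mul, abs_of_pos (Real.rpow_pos_of_pos h0 δ)] at h2
  calc _ ≤ (|Real.log ‖x‖| + Real.pi) * ‖x‖ ^ δ := by gcongr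
    _ = |Real.log ‖x‖| * ‖x‖ ^ δ + Real.pi * ‖x‖ ^ δ := by ring
    _ ≤ 1 / δ + Real.pi * 1 := by
      gcongr
      exact Real.rpow_le_one h0.le hx1 hδ.le
    _ = _ := by ring

lemma continuousOn_cpow_planeSector {θm θM R : ℝ} (hθM : θM < Real.pi) (s : ℂ) :
    ContinuousOn (fun x => planeToComplex x ^ s) (planeSector θm θM R) := fun _ hx =>
  (ContinuousAt.comp (g := fun z : ℂ => z ^ s)
    (continuousAt_cpow_const (slitPlane_of_mem_planeSector hθM hx))
    planeToComplex.continuous.continuousAt).continuousWithinAt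

lemma aestronglyMeasurable_cpow_planeSector {θm θM R : ℝ} (hθM : θM < Real.pi) (s : ℂ) :
    AEStronglyMeasurable (fun x => planeToComplex x ^ s)
      (volume.restrict (planeSector θm θM R)) :=
  (continuousOn_cpow_planeSector hθM s).aestronglyMeasurable
    (isOpen_planeSector hθM R).measurableSet

lemma aestronglyMeasurable_log_planeSector {θm θM R : ℝ} (hθM : θM < Real.pi) :
    AEStronglyMeasurable (fun x => Complex.log (planeToComplex x))
      (volume.restrict (planeSector θm θM R)) :=
  ContinuousOn.aestronglyMeasurable (fun _ hx => (ContinuousAt.comp (g := Complex.log)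
      (continuousAt_clog (slitPlane_of_mem_planeSector hθM hx))
      planeToComplex.continuous.continuousAt).continuousWithinAt)
    (isOpen_planeSector hθM R).measurableSet

lemma integrable_mul_cpow_planeSector {θm θM R : ℝ} (hθM : θM < Real.pi)
    {h : Plane → ℂ} (hm : AEStronglyMeasurable h (volume.restrict (planeSector θm θM R))) {s : ℂ}
    (hi : Integrable (fun x => ‖h x‖ * ‖x‖ ^ s.re) (volume.restrict (planeSector θm θM R))) :
    Integrable (fun x => h x * planeToComplex x ^ s)
      (volume.restrict (planeSector θm θM R)) := by
  refine (hi.mul_const (Real.exp (Real.pi * |s.im|))).mono'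
    (hm.mul (aestronglyMeasurable_cpow_planeSector hθM s)) ?_
  filter_upwards [ae_mem_planeSector hθM] with x hx
  rw [norm_mul, mul_assoc]
  gcongr
  exact norm_cpow_planeToComplex_le (mem_planeSector.1 hx).1.1 s

/-- Integrals of `h z ^ s` over a sector depend holomorphically on `s`. -/
lemma differentiableOn_integral_mul_cpow {θm θM R : ℝ} (hθM : θM < Real.pi) (hR1 : R ≤ 1)
    {h : Plane → ℂ} (hm : AEStronglyMeasurable h (volume.restrict (planeSector θm θM R))) {a : ℝ}
    (hi : ∀ σ, a < σ → Integrable (fun x => ‖h x‖ * ‖x‖ ^ σ)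
      (volume.restrict (planeSector θm θM R))) :
    DifferentiableOn ℂ (fun s => ∫ x in planeSector θm θM R, h x * planeToComplex x ^ s)
      {s : ℂ | a < s.re} := by
  intro s₀ hs₀
  -- The margin `δ` is spent twice: once to let `s` range over a ball around `s₀`, once to absorb
  -- the logarithm produced by differentiating in `s`.
  obtain ⟨δ, hδ, hδa⟩ : ∃ δ : ℝ, 0 < δ ∧ a < s₀.re - δ - δ :=
    ⟨(s₀.re - a) / 3, by have : a < s₀.re := hs₀; linarith, by
      have : a < s₀.re := hs₀; linarith⟩
  set E := Real.exp (Real.pi * (|s₀.im| + δ)) with hE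
  refine (hasDerivAt_integral_of_dominated_loc_of_deriv_le (Metric.ball_mem_nhds s₀ hδ)
    (F' := fun s x => h x * (planeToComplex x ^ s * Complex.log (planeToComplex x)))
    (bound := fun x => (‖h x‖ * ‖x‖ ^ (s₀.re - δ - δ)) * (E * (1 / δ + Real.pi)))
    (Eventually.of_forall fun s => hm.mul (aestronglyMeasurable_cpow_planeSector hθM s))
    (integrable_mul_cpow_planeSector hθM hm (hi _ hs₀))
    (hm.mul ((aestronglyMeasurable_cpow_planeSector hθM s₀).mul
      (aestronglyMeasurable_log_planeSector hθM))) ?_ ((hi _ hδa).mul_const _)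
    ?_).2.differentiableAt.differentiableWithinAt
  · filter_upwards [ae_mem_planeSector hθM] with x hx s hs
    have hx0 : x ≠ 0 := (mem_planeSector.1 hx).1.1
    have hpos : 0 < ‖x‖ := norm_pos_iff.2 hx0
    have hx1 : ‖x‖ ≤ 1 := (mem_planeSector.1 hx).2.le.trans hR1
    have hs' : ‖s - s₀‖ < δ := by rwa [← dist_eq_norm]
    have hre : s₀.re - δ ≤ s.re := by
      have := (abs_le.1 (Complex.abs_re_le_norm (s - s₀))).1
      rw [Complex.sub_re] at this
      linarith
    have him : |s.im| ≤ |s₀.im| + δ := by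
      have h1 := Complex.abs_im_le_norm (s - s₀)
      rw [Complex.sub_im] at h1
      have := abs_sub_abs_le_abs_sub s.im s₀.im
      linarith
    have hc : ‖planeToComplex x ^ s‖ ≤ ‖x‖ ^ (s₀.re - δ - δ) * ‖x‖ ^ δ * E := by
      refine (norm_cpow_planeToComplex_le hx0 s).trans ?_
      rw [← Real.rpow_add hpos, sub_add_cancel]
      gcongr ?_ * ?_
      · exact Real.rpow_le_rpow_of_exponent_ge hpos hx1 hre
      · rw [hE]
        gcongr
    have hl := norm_log_planeToComplex_mul_rpow_le hx0 hx1 hδ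
    rw [norm_mul, norm_mul]
    calc ‖h x‖ * (‖planeToComplex x ^ s‖ * ‖Complex.log (planeToComplex x)‖)
        ≤ ‖h x‖ * ((‖x‖ ^ (s₀.re - δ - δ) * ‖x‖ ^ δ * E) *
          ‖Complex.log (planeToComplex x)‖) := by gcongr
      _ = ‖h x‖ * ‖x‖ ^ (s₀.re - δ - δ) * (E *
          (‖Complex.log (planeToComplex x)‖ * ‖x‖ ^ δ)) := by ring
      _ ≤ _ := by gcongr
  · filter_upwards [ae_mem_planeSector hθM] with x hx s _
    have hz : planeToComplex x ≠ 0 :=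
      Complex.slitPlane_ne_zero (slitPlane_of_mem_planeSector hθM hx)
    have := (hasDerivAt_id s).const_cpow (c := planeToComplex x) (Or.inl hz)
    simpa using this.const_mul (h x)

/-- For `|x| ≤ 1` the power `|x| ^ s` decreases in `s`, so one bound at the endpoint `a` serves all
real `s ≥ a`. -/
lemma norm_integral_mul_cpow_le {θm θM R : ℝ} (hθM : θM < Real.pi) (hR1 : R ≤ 1)
    {h : Plane → ℂ} {a s : ℝ} (has : a ≤ s)
    (hi : Integrable (fun x => ‖h x‖ * ‖x‖ ^ a) (volume.restrict (planeSector θm θM R))) :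
    ‖∫ x in planeSector θm θM R, h x * planeToComplex x ^ (s : ℂ)‖ ≤
      ∫ x in planeSector θm θM R, ‖h x‖ * ‖x‖ ^ a := by
  refine norm_integral_le_of_norm_le hi ?_
  filter_upwards [ae_mem_planeSector hθM] with x hx
  have hx' := mem_planeSector.1 hx
  rw [norm_mul, norm_cpow_planeToComplex_real hx'.1.1]
  refine mul_le_mul_of_nonneg_left ?_ (norm_nonneg _)
  exact Real.rpow_le_rpow_of_exponent_ge (norm_pos_iff.2 hx'.1.1) (hx'.2.le.trans hR1) has

lemma polarPoint_cpow {ρ θ : ℝ} (hρ : 0 < ρ) (hθ : θ ∈ Set.Ioc (-Real.pi) Real.pi) (s : ℝ) :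
    planeToComplex (polarPoint ρ θ) ^ (s : ℂ) =
      ((ρ ^ s : ℝ) : ℂ) * Complex.exp (s * Complex.I * θ) := by
  have hz : planeToComplex (polarPoint ρ θ) ≠ 0 := by
    rw [← norm_ne_zero_iff, LinearIsometryEquiv.norm_map, norm_polarPoint, abs_of_pos hρ]
    exact hρ.ne'
  have hlog : Complex.log (planeToComplex (polarPoint ρ θ)) = Real.log ρ + θ * Complex.I := by
    rw [Complex.log, arg_polarPoint hρ hθ, LinearIsometryEquiv.norm_map, norm_polarPoint,
      abs_of_pos hρ]
  rw [Complex.cpow_def_of_ne_zero hz, hlog, add_mul, Complex.exp_add, Real.rpow_def_of_pos hρ]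
  push_cast
  congr 2
  ring

/-- The integral separates in polar coordinates. The radial factor `R ^ (s + 2) / (s + 2)` carries
the pole at `-2`, the angular factor its residue. -/
lemma integral_cpow_planeSector {θm θM R : ℝ} (hθm : -Real.pi < θm) (hθ : θm < θM)
    (hθM : θM < Real.pi) (hR : 0 < R) {s : ℝ} (hs : -2 < s) (hs0 : s ≠ 0) :
    ∫ x in planeSector θm θM R, planeToComplex x ^ (s : ℂ) =
      ((R ^ (s + 2) / (s + 2) : ℝ) : ℂ) *
        ((Complex.exp (s * Complex.I * θM) - Complex.exp (s * Complex.I * θm)) /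
          (s * Complex.I)) := by
  rw [setIntegral_planeSector hθm hθM]
  have h1 : ∫ p in Set.Ioo 0 R ×ˢ Set.Ioo θm θM,
      p.1 • planeToComplex (polarPoint p.1 p.2) ^ (s : ℂ) =
      ∫ p in Set.Ioo 0 R ×ˢ Set.Ioo θm θM,
        ((p.1 ^ (s + 1) : ℝ) : ℂ) * Complex.exp (s * Complex.I * p.2) := by
    refine setIntegral_congr_fun (measurableSet_Ioo.prod measurableSet_Ioo) fun p hp => ?_
    simp only [Complex.real_smul]
    rw [polarPoint_cpow hp.1.1 ⟨hθm.trans hp.2.1, (hp.2.2.trans hθM).le⟩,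
      Real.rpow_add_one hp.1.1.ne']
    push_cast
    ring
  rw [h1, Measure.volume_eq_prod, setIntegral_prod_mul (fun ρ : ℝ => ((ρ ^ (s + 1) : ℝ) : ℂ))
    (fun θ : ℝ => Complex.exp (s * Complex.I * θ)), integral_complex_ofReal,
    ← integral_Ioc_eq_integral_Ioo, ← integral_Ioc_eq_integral_Ioo,
    ← intervalIntegral.integral_of_le hR.le, ← intervalIntegral.integral_of_le hθ.le,
    integral_rpow (Or.inl (by linarith)), integral_exp_mul_complex
      (mul_ne_zero (by exact_mod_cast hs0) Complex.I_ne_zero), Real.zero_rpow (by linarith),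
    sub_zero, add_assoc]
  norm_num

/-- Equality would make `θM - θm` an integer multiple of `π`; strictly between `0` and `2π` the only
one is `π` itself. -/
lemma exp_neg_two_angle_ne {θm θM : ℝ} (hθm : -Real.pi < θm) (hθ : θm < θM)
    (hθM : θM < Real.pi) (hne : θM ≠ θm + Real.pi) :
    Complex.exp (-2 * Complex.I * θM) ≠ Complex.exp (-2 * Complex.I * θm) := by
  intro h
  obtain ⟨n, hn⟩ := Complex.exp_eq_exp_iff_exists_int.1 h
  have h1 : θM = θm - n * Real.pi := by
    have := congrArg Complex.im hn
    simp at this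
    linarith
  have hpi := Real.pi_pos
  have h2 : (n : ℝ) < 0 := by nlinarith
  have h3 : (-2 : ℝ) < n := by nlinarith
  have h4 : n = -1 := by
    have h5 : n < 0 := by exact_mod_cast h2
    have h6 : -2 < n := by exact_mod_cast h3
    omega
  rw [h4] at h1
  push_cast at h1
  exact hne (by linarith)

/-! ### Absence of a pole at `-2` -/

lemma norm_planeNormSq (x : Plane) : ‖planeNormSq x‖ = ‖x‖ ^ 2 := by
  rw [planeNormSq_eq, Complex.norm_real, Real.norm_of_nonneg (by positivity)]

lemma norm_radialCutoff_le {R : ℝ} (hR : 0 < R) (hR1 : R ≤ 1) {x : Plane} (hx : ‖x‖ ≤ 1) :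
    ‖radialCutoff R x‖ ≤ 4 := by
  have h : ‖(R : ℂ) ^ 4 - planeNormSq x ^ 2‖ ≤ 1 + 1 := by
    refine (norm_sub_le _ _).trans ?_
    rw [norm_pow, norm_pow, norm_planeNormSq, Complex.norm_real, Real.norm_of_nonneg hR.le]
    gcongr
    · exact pow_le_one₀ hR.le hR1
    · exact pow_le_one₀ (by positivity) (pow_le_one₀ (norm_nonneg x) hx)
  rw [radialCutoff, norm_pow]
  calc _ ≤ ((1 : ℝ) + 1) ^ 2 := by gcongr
    _ = 4 := by norm_num

lemma norm_radialCutoff_sub_le {R : ℝ} (hR : 0 < R) (hR1 : R ≤ 1) {x : Plane} (hx : ‖x‖ ≤ 1) :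
    ‖radialCutoff R x - (R : ℂ) ^ 8‖ ≤ 3 * ‖x‖ ^ 4 := by
  have h : ‖planeNormSq x ^ 2 - 2 * (R : ℂ) ^ 4‖ ≤ 1 + 2 * 1 := by
    refine (norm_sub_le _ _).trans ?_
    rw [norm_pow, norm_mul, norm_pow, norm_planeNormSq, Complex.norm_real,
      Real.norm_of_nonneg hR.le, Complex.norm_two]
    gcongr
    · exact pow_le_one₀ (by positivity) (pow_le_one₀ (norm_nonneg x) hx)
    · exact pow_le_one₀ hR.le hR1
  have h2 : radialCutoff R x - (R : ℂ) ^ 8 =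
      planeNormSq x ^ 2 * (planeNormSq x ^ 2 - 2 * (R : ℂ) ^ 4) := by
    rw [radialCutoff]
    ring
  rw [h2, norm_mul, norm_pow, norm_planeNormSq]
  calc _ ≤ (‖x‖ ^ 2) ^ 2 * (1 + 2 * 1) := by gcongr
    _ = _ := by ring

lemma norm_planeNormSq_mul_le {R c : ℝ} (hR : 0 < R) (hR1 : R ≤ 1) {x : Plane} (hx : ‖x‖ ≤ 1) :
    ‖planeNormSq x * ((R : ℂ) ^ 4 - c * planeNormSq x ^ 2)‖ ≤ (1 + |c|) * ‖x‖ ^ (2 : ℝ) := by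
  have h : ‖(R : ℂ) ^ 4 - c * planeNormSq x ^ 2‖ ≤ 1 + |c| * 1 := by
    refine (norm_sub_le _ _).trans ?_
    rw [norm_pow, norm_mul, norm_pow, norm_planeNormSq, Complex.norm_real, Complex.norm_real,
      Real.norm_of_nonneg hR.le, Real.norm_eq_abs]
    gcongr
    · exact pow_le_one₀ hR.le hR1
    · exact pow_le_one₀ (by positivity) (pow_le_one₀ (norm_nonneg x) hx)
  rw [norm_mul, norm_planeNormSq, Real.rpow_two, mul_comm]
  gcongr
  simpa using h

/-- The quadratic zero of `p` compensates `|x| ^ σ` down to and including `σ = -2`, so integrability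
of `w` is enough at the endpoint. -/
lemma integrable_mul_norm_rpow_of_quadratic {θm θM R : ℝ} (hθM : θM < Real.pi) (hR1 : R ≤ 1)
    {w p : Plane → ℂ} (hw : Integrable w (volume.restrict (planeSector θm θM R)))
    (hp : Continuous p) {C : ℝ} (hC : ∀ x, ‖x‖ ≤ 1 → ‖p x‖ ≤ C * ‖x‖ ^ (2 : ℝ)) {σ : ℝ}
    (hσ : -2 ≤ σ) :
    Integrable (fun x => ‖w x * p x‖ * ‖x‖ ^ σ) (volume.restrict (planeSector θm θM R)) := by
  refine (hw.norm.mul_const C).mono'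
    ((hw.1.mul hp.aestronglyMeasurable).norm.mul (aestronglyMeasurable_norm_rpow σ)) ?_
  filter_upwards [ae_mem_planeSector hθM] with x hx
  have hx' := mem_planeSector.1 hx
  have h0 : 0 < ‖x‖ := norm_pos_iff.2 hx'.1.1
  have hx1 : ‖x‖ ≤ 1 := hx'.2.le.trans hR1
  have hC0 : 0 ≤ C := by
    have := (norm_nonneg _).trans (hC x hx1)
    exact nonneg_of_mul_nonneg_left this (Real.rpow_pos_of_pos h0 2)
  rw [Real.norm_of_nonneg (by positivity), norm_mul, mul_assoc]
  gcongr
  calc ‖p x‖ * ‖x‖ ^ σ ≤ C * ‖x‖ ^ (2 : ℝ) * ‖x‖ ^ σ := by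
        gcongr
        exact hC x hx1
    _ = C * ‖x‖ ^ (2 + σ) := by rw [Real.rpow_add h0, mul_assoc]
    _ ≤ C * 1 := by
      gcongr
      exact Real.rpow_le_one h0.le hx1 (by linarith)
    _ = C := mul_one C

lemma tendsto_mul_of_bounded {F : ℝ → ℂ} {C : ℝ} (h : ∀ t ∈ Set.Ioo (0 : ℝ) 1, ‖F t‖ ≤ C) :
    Tendsto (fun t : ℝ => (t : ℂ) * F t) (𝓝[>] 0) (𝓝 0) := by
  have h1 : Tendsto (fun t : ℝ => (t : ℂ)) (𝓝[>] 0) (𝓝 0) := by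
    have := (Complex.continuous_ofReal.tendsto 0).mono_left (nhdsWithin_le_nhds (s := Set.Ioi 0))
    simpa using this
  refine h1.zero_mul_isBoundedUnder_le ⟨C, ?_⟩
  rw [eventually_map]
  filter_upwards [Ioo_mem_nhdsGT one_pos] with t ht
  exact h t ht

/-- If a function with a Hölder-type limit `g₀` at the vertex has, against all sufficiently high
powers of `z`, the same pairing as the Laplacian of a function with zero Cauchy data, then
`g₀ = 0`, because the meromorphic continuation of the pairing has no pole at `-2`. -/
theorem vertex_value_eq_zero {θm θM R : ℝ} (hθm : -Real.pi < θm) (hθ : θm < θM)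
    (hθM : θM < Real.pi) (hne : θM ≠ θm + Real.pi) (hR : 0 < R) (hR1 : R ≤ 1) {g w : Plane → ℂ}
    {g₀ : ℂ} {K α : ℝ} (hα : 0 < α) (hK : 0 ≤ K)
    (hgm : AEStronglyMeasurable g (volume.restrict (planeSector θm θM R)))
    (hg : ∀ x ∈ planeSector θm θM R, ‖g x - g₀‖ ≤ K * ‖x‖ ^ α)
    (hw : Integrable w (volume.restrict (planeSector θm θM R)))
    (hid : ∀ s : ℂ, 2 < s.re →
      ∫ x in planeSector θm θM R, g x * (radialCutoff R x * planeToComplex x ^ s) =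
        ∫ x in planeSector θm θM R, w x * (cutoffLaplacian R s x * planeToComplex x ^ s)) :
    g₀ = 0 := by
  -- `cutoffLaplacian R s` is affine in `s`, equal to `s a + b`, so its dependence on `s` leaves the
  -- integrals as the factor of `A`.
  set a : Plane → ℂ := fun x => -16 * (planeNormSq x * ((R : ℂ) ^ 4 - (1 : ℝ) * planeNormSq x ^ 2))
    with ha
  set b : Plane → ℂ := fun x => -32 * (planeNormSq x * ((R : ℂ) ^ 4 - (2 : ℝ) * planeNormSq x ^ 2))
    with hb
  have hN := continuous_planeNormSq
  have hac : Continuous a := by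
    rw [ha]
    fun_prop
  have hbc : Continuous b := by
    rw [hb]
    fun_prop
  have ha2 : ∀ x : Plane, ‖x‖ ≤ 1 → ‖a x‖ ≤ (16 * (1 + |1|)) * ‖x‖ ^ (2 : ℝ) := fun x hx => by
    rw [ha, norm_mul, mul_assoc]
    gcongr
    · simp
    · exact norm_planeNormSq_mul_le hR hR1 hx
  have hb2 : ∀ x : Plane, ‖x‖ ≤ 1 → ‖b x‖ ≤ (32 * (1 + |2|)) * ‖x‖ ^ (2 : ℝ) := fun x hx => by
    rw [hb, norm_mul, mul_assoc]
    gcongr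
    · simp
    · exact norm_planeNormSq_mul_le hR hR1 hx
  have hia : ∀ σ : ℝ, -2 ≤ σ → _ := fun σ hσ =>
    integrable_mul_norm_rpow_of_quadratic hθM hR1 hw hac ha2 hσ
  have hib : ∀ σ : ℝ, -2 ≤ σ → _ := fun σ hσ =>
    integrable_mul_norm_rpow_of_quadratic hθM hR1 hw hbc hb2 hσ
  have ham := hw.1.mul (hac.aestronglyMeasurable (μ := volume.restrict (planeSector θm θM R)))
  have hbm := hw.1.mul (hbc.aestronglyMeasurable (μ := volume.restrict (planeSector θm θM R)))
  have hχm := (continuous_radialCutoff R).aestronglyMeasurable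
    (μ := volume.restrict (planeSector θm θM R))
  have hcm := hgm.mul hχm
  have hlem : ∀ x ∈ planeSector θm θM R, ‖x‖ ≤ 1 := fun x hx => (mem_planeSector.1 hx).2.le.trans hR1
  have hcb : ∀ᵐ x ∂volume.restrict (planeSector θm θM R),
      ‖g x * radialCutoff R x‖ ≤ ((K + ‖g₀‖) * 4) * ‖x‖ ^ (0 : ℝ) := by
    filter_upwards [ae_mem_planeSector hθM] with x hx
    rw [norm_mul, Real.rpow_zero, mul_one]
    gcongr
    · have h1 := norm_le_norm_add_norm_sub' (g x) g₀
      have h2 : K * ‖x‖ ^ α ≤ K * 1 := by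
        gcongr
        exact Real.rpow_le_one (norm_nonneg x) (hlem x hx) hα.le
      linarith [hg x hx]
    · exact norm_radialCutoff_le hR hR1 (hlem x hx)
  have hic : ∀ σ : ℝ, -2 < σ → Integrable (fun x => ‖g x * radialCutoff R x‖ * ‖x‖ ^ σ)
      (volume.restrict (planeSector θm θM R)) := fun σ hσ =>
    integrable_norm_mul_rpow_of_le hθM hR hcm hcb (by linarith)
  have hem : AEStronglyMeasurable (fun x => g x * radialCutoff R x - g₀ * (R : ℂ) ^ 8)
      (volume.restrict (planeSector θm θM R)) := hcm.sub aestronglyMeasurable_const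
  -- The exponent `α` comes from the Hölder bound on `g`, the exponent `4` from `χ - R⁸`. Any
  -- positive exponent makes the error integrable against `|x| ^ (-2)`.
  have heb : ∀ᵐ x ∂volume.restrict (planeSector θm θM R),
      ‖g x * radialCutoff R x - g₀ * (R : ℂ) ^ 8‖ ≤ (K * 4 + ‖g₀‖ * 3) * ‖x‖ ^ min α 4 := by
    filter_upwards [ae_mem_planeSector hθM] with x hx
    have hx1 := hlem x hx
    have h0 : 0 < ‖x‖ := norm_pos_iff.2 (mem_planeSector.1 hx).1.1
    have h1 : g x * radialCutoff R x - g₀ * (R : ℂ) ^ 8 =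
        (g x - g₀) * radialCutoff R x + g₀ * (radialCutoff R x - (R : ℂ) ^ 8) := by ring
    have h2 : ‖x‖ ^ α ≤ ‖x‖ ^ min α 4 :=
      Real.rpow_le_rpow_of_exponent_ge h0 hx1 (min_le_left _ _)
    have h3 : ‖x‖ ^ 4 ≤ ‖x‖ ^ min α 4 := by
      have := Real.rpow_le_rpow_of_exponent_ge h0 hx1 (min_le_right α 4)
      rwa [show (4 : ℝ) = ((4 : ℕ) : ℝ) by norm_num, Real.rpow_natCast] at this
    rw [h1]
    refine (norm_add_le _ _).trans ?_
    rw [norm_mul, norm_mul]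
    calc _ ≤ (K * ‖x‖ ^ min α 4) * 4 + ‖g₀‖ * (3 * ‖x‖ ^ min α 4) := by
          gcongr
          · exact (hg x hx).trans (by gcongr)
          · exact norm_radialCutoff_le hR hR1 hx1
          · exact (norm_radialCutoff_sub_le hR hR1 hx1).trans (by gcongr)
      _ = _ := by ring
  have hie : Integrable (fun x => ‖g x * radialCutoff R x - g₀ * (R : ℂ) ^ 8‖ * ‖x‖ ^ (-2 : ℝ))
      (volume.restrict (planeSector θm θM R)) :=
    integrable_norm_mul_rpow_of_le hθM hR hem heb (by
      have : 0 < min α 4 := lt_min hα (by norm_num)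
      linarith)
  set A : ℂ → ℂ := fun s => ∫ x in planeSector θm θM R, w x * a x * planeToComplex x ^ s with hA
  set B : ℂ → ℂ := fun s => ∫ x in planeSector θm θM R, w x * b x * planeToComplex x ^ s with hB
  set G : ℂ → ℂ := fun s =>
    ∫ x in planeSector θm θM R, g x * radialCutoff R x * planeToComplex x ^ s with hG
  have hopen : IsOpen {s : ℂ | (-2 : ℝ) < s.re} := isOpen_lt continuous_const Complex.continuous_re
  have hAd : DifferentiableOn ℂ A {s : ℂ | (-2 : ℝ) < s.re} :=
    differentiableOn_integral_mul_cpow hθM hR1 ham fun σ hσ => hia σ hσ.le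
  have hBd : DifferentiableOn ℂ B {s : ℂ | (-2 : ℝ) < s.re} :=
    differentiableOn_integral_mul_cpow hθM hR1 hbm fun σ hσ => hib σ hσ.le
  have hGd : DifferentiableOn ℂ G {s : ℂ | (-2 : ℝ) < s.re} :=
    differentiableOn_integral_mul_cpow hθM hR1 hcm hic
  have hGAB : ∀ s : ℂ, 2 < s.re → G s = s * A s + B s := by
    intro s hs
    have h1 : Integrable (fun x => w x * a x * planeToComplex x ^ s)
        (volume.restrict (planeSector θm θM R)) :=
      integrable_mul_cpow_planeSector hθM ham (hia _ (by linarith))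
    have h2 : Integrable (fun x => w x * b x * planeToComplex x ^ s)
        (volume.restrict (planeSector θm θM R)) :=
      integrable_mul_cpow_planeSector hθM hbm (hib _ (by linarith))
    have h3 := hid s hs
    simp only [← mul_assoc] at h3
    rw [hG, hA, hB]
    simp only
    rw [h3, ← integral_const_mul, ← integral_add (h1.const_mul s) h2]
    congr 1
    ext x
    simp only [cutoffLaplacian, ha, hb]
    push_cast
    ring
  -- Identity theorem on a convex half-plane; the base point `3` is any point with real part above
  -- `2`.
  have hcont : Set.EqOn G (fun s => s * A s + B s) {s : ℂ | (-2 : ℝ) < s.re} := by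
    refine (hGd.analyticOnNhd hopen).eqOn_of_preconnected_of_eventuallyEq
      (((differentiableOn_id.mul hAd).add hBd).analyticOnNhd hopen)
      (convex_halfSpace_re_gt (-2)).isPreconnected (z₀ := 3) (by simp; norm_num) ?_
    have : {s : ℂ | 2 < s.re} ∈ 𝓝 (3 : ℂ) :=
      (isOpen_lt continuous_const Complex.continuous_re).mem_nhds (by simp; norm_num)
    filter_upwards [this] with s hs
    exact hGAB s hs
  -- Through the extended identity, `G` is bounded near `-2` although its own integrand is not
  -- absolutely controlled there.
  have hlim0 : Tendsto (fun t : ℝ => (t : ℂ) * G ((-2 + t : ℝ) : ℂ)) (𝓝[>] 0) (𝓝 0) := by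
    refine tendsto_mul_of_bounded (C := 2 * (∫ x in planeSector θm θM R,
      ‖w x * a x‖ * ‖x‖ ^ (-2 : ℝ)) + ∫ x in planeSector θm θM R,
      ‖w x * b x‖ * ‖x‖ ^ (-2 : ℝ)) fun t ht => ?_
    rw [hcont (by simpa using ht.1)]
    refine (norm_add_le _ _).trans ?_
    rw [norm_mul]
    gcongr
    · rw [Complex.norm_real, Real.norm_eq_abs, abs_le]
      constructor <;> linarith [ht.1, ht.2]
    · exact norm_integral_mul_cpow_le hθM hR1 (by linarith [ht.1]) (hia _ le_rfl)
    · exact norm_integral_mul_cpow_le hθM hR1 (by linarith [ht.1]) (hib _ le_rfl)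
  have hlim1 : Tendsto (fun t : ℝ => (t : ℂ) * ∫ x in planeSector θm θM R,
      (g x * radialCutoff R x - g₀ * (R : ℂ) ^ 8) * planeToComplex x ^ ((-2 + t : ℝ) : ℂ))
      (𝓝[>] 0) (𝓝 0) :=
    tendsto_mul_of_bounded fun t ht =>
      norm_integral_mul_cpow_le hθM hR1 (by linarith [ht.1]) hie
  -- `L t` is `t` times the integral of `z ^ (-2 + t)` over the sector, in closed form and
  -- continuous at `t = 0`.
  set L : ℝ → ℂ := fun t => ((R ^ t : ℝ) : ℂ) *
    ((Complex.exp (((-2 + t : ℝ) : ℂ) * Complex.I * θM) -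
      Complex.exp (((-2 + t : ℝ) : ℂ) * Complex.I * θm)) / (((-2 + t : ℝ) : ℂ) * Complex.I)) with hL
  have hlimL : Tendsto L (𝓝[>] 0) (𝓝 (L 0)) := by
    refine ContinuousAt.tendsto (f := L) ?_ |>.mono_left nhdsWithin_le_nhds
    have h1 : Continuous fun t : ℝ => ((R ^ t : ℝ) : ℂ) :=
      Complex.continuous_ofReal.comp (Real.continuous_const_rpow hR.ne')
    have h2 : Continuous fun t : ℝ => Complex.exp (((-2 + t : ℝ) : ℂ) * Complex.I * θM) -
      Complex.exp (((-2 + t : ℝ) : ℂ) * Complex.I * θm) := by fun_prop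
    have h3 : Continuous fun t : ℝ => ((-2 + t : ℝ) : ℂ) * Complex.I := by fun_prop
    exact h1.continuousAt.mul (h2.continuousAt.div h3.continuousAt (by simp))
  have hL0 : L 0 ≠ 0 := by
    have := sub_ne_zero.2 (exp_neg_two_angle_ne hθm hθ hθM hne)
    simp only [hL, Real.rpow_zero, add_zero]
    push_cast
    rw [one_mul]
    exact div_ne_zero this (by simp)
  have hsplit : (fun t : ℝ => (t : ℂ) * G ((-2 + t : ℝ) : ℂ) - (t : ℂ) * ∫ x in planeSector θm θM R,
      (g x * radialCutoff R x - g₀ * (R : ℂ) ^ 8) * planeToComplex x ^ ((-2 + t : ℝ) : ℂ))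
      =ᶠ[𝓝[>] 0] fun t => g₀ * (R : ℂ) ^ 8 * L t := by
    filter_upwards [Ioo_mem_nhdsGT one_pos] with t ht
    have h1 : Integrable (fun x => g x * radialCutoff R x * planeToComplex x ^ ((-2 + t : ℝ) : ℂ))
        (volume.restrict (planeSector θm θM R)) :=
      integrable_mul_cpow_planeSector hθM hcm (hic _ (by
        rw [Complex.ofReal_re]; linarith [ht.1]))
    have h2 : Integrable (fun x => planeToComplex x ^ ((-2 + t : ℝ) : ℂ))
        (volume.restrict (planeSector θm θM R)) := by
      have := integrable_mul_cpow_planeSector (h := fun _ => (1 : ℂ)) (s := ((-2 + t : ℝ) : ℂ)) hθM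
        (aestronglyMeasurable_const (μ := volume.restrict (planeSector θm θM R)))
        (by simpa using integrable_norm_rpow_planeSector hR (by linarith [ht.1]))
      simpa using this
    have h3 := integral_cpow_planeSector hθm hθ hθM hR (s := -2 + t) (by linarith [ht.1])
      (by linarith [ht.2])
    simp only [sub_mul]
    rw [integral_sub h1 (h2.const_mul _), integral_const_mul, h3, hG, hL]
    have ht0 : (t : ℂ) ≠ 0 := by exact_mod_cast ht.1.ne'
    have h4 : -2 + t + 2 = t := by ring
    simp only [h4]
    push_cast
    field_simp
    ring
  have hzero := tendsto_nhds_unique ((hlim0.sub hlim1).congr' hsplit)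
    (hlimL.const_mul (g₀ * (R : ℂ) ^ 8))
  have hR0 : (R : ℂ) ≠ 0 := by exact_mod_cast hR.ne'
  simpa [hL0, hR0] using hzero.symm

/-! ### The theorem -/

theorem proposition3p3
    (Ω : Set Plane) (hΩ_open : IsOpen Ω) (hΩ_conn : IsConnected Ω)
    (hΩ_bdd : Bornology.IsBounded Ω)
    (θm θM : ℝ) (hθm : -Real.pi < θm) (hθ : θm < θM) (hθM : θM < Real.pi)
    (hθ_ne : θM ≠ θm + Real.pi)
    (h0 : (0 : Plane) ∈ frontier Ω)
    (r : ℝ) (hr : 0 < r)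
    (hcone : Ω ∩ Metric.ball 0 r = planeCone θm θM ∩ Metric.ball 0 r)
    (u u' f f' : Plane → ℂ)
    (hu : MemH2 (Ω ∩ Metric.ball 0 r) u) (hu' : MemH2 (Ω ∩ Metric.ball 0 r) u')
    (α : ℝ≥0) (hα : 0 < α)
    (hf : ∃ K : ℝ≥0, HolderOnWith K α f (closure (Ω ∩ Metric.ball 0 r)))
    (hf' : ∃ K : ℝ≥0, HolderOnWith K α f' (closure (Ω ∩ Metric.ball 0 r)))
    (hΔ : SolvesPoisson (Ω ∩ Metric.ball 0 r) u f)
    (hΔ' : SolvesPoisson (Ω ∩ Metric.ball 0 r) u' f')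
    (hCauchy : SameCauchyData (Ω ∩ Metric.ball 0 r) (frontier Ω ∩ Metric.ball 0 r) u u') :
    f 0 = f' 0 := by
  obtain ⟨K, hf⟩ := hf
  obtain ⟨K', hf'⟩ := hf'
  have hcone' : Ω ∩ Metric.ball 0 r = planeSector θm θM r := hcone
  have hcl : (0 : Plane) ∈ closure (planeSector θm θM r) := by
    rw [← hcone', Set.inter_comm]
    exact Metric.isOpen_ball.inter_closure ⟨Metric.mem_ball_self hr, h0.1⟩
  rw [hcone'] at hf hf' hΔ hΔ' hCauchy
  obtain ⟨v, d, Φ, V, hw, hv, hd, hΦ, hV, hΦw, hΦv, hVv, hVd, hbΦ, hbV, hfd⟩ :=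
    hCauchy.exists_approx hθm hθ hθM
      (fun θ hθ' ρ hρ => polarPoint_mem_frontier hΩ_open hθm hθ hθM hcone' hθ' hρ) hΔ hΔ'
  -- Shrinking to radius at most `1` makes powers of `|x|` monotone in the exponent; all
  -- convergences restrict to the smaller sector.
  set R := min r 1
  have hR : 0 < R := lt_min hr one_pos
  have hsub : planeSector θm θM R ⊆ planeSector θm θM r :=
    Set.inter_subset_inter_right _ (Metric.ball_subset_ball (min_le_left _ _))
  have hμ : volume.restrict (planeSector θm θM R) ≤ volume.restrict (planeSector θm θM r) :=
    Measure.restrict_mono hsub le_rfl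
  have hμ' : volume.restrict (Set.Ioo 0 R) ≤ volume.restrict (Set.Ioo 0 r) :=
    Measure.restrict_mono (Set.Ioo_subset_Ioo_right (min_le_left _ _)) le_rfl
  have hmono : ∀ {F : ℕ → Plane → ℂ}, Tendsto (fun n => eLpNorm (F n) 2
      (volume.restrict (planeSector θm θM r))) atTop (𝓝 0) → Tendsto (fun n => eLpNorm (F n) 2
      (volume.restrict (planeSector θm θM R))) atTop (𝓝 0) := fun h =>
    tendsto_of_tendsto_of_tendsto_of_le_of_le tendsto_const_nhds h (fun _ => zero_le)
      fun n => eLpNorm_mono_measure _ hμ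
  have hmono' : ∀ {F : ℕ → ℝ → ℂ}, Tendsto (fun n => eLpNorm (F n) 2
      (volume.restrict (Set.Ioo 0 r))) atTop (𝓝 0) → Tendsto (fun n => eLpNorm (F n) 2
      (volume.restrict (Set.Ioo 0 R))) atTop (𝓝 0) := fun h =>
    tendsto_of_tendsto_of_tendsto_of_le_of_le tendsto_const_nhds h (fun _ => zero_le)
      fun n => eLpNorm_mono_measure _ hμ'
  have hwR := hw.mono_measure hμ
  have hid := fun (s : ℂ) (hs : 2 < s.re) => integral_laplacian_mul_cpow hθm hθ hθM hR hwR
    (fun i => (hv i).mono_measure hμ) (fun i => (hd i).mono_measure hμ) hΦ hV (hmono hΦw)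
    (fun i => hmono (hΦv i)) (fun i => hmono (hVv i)) (fun i => hmono (hVd i))
    (fun θ hθ' => hmono' (hbΦ θ hθ')) (fun θ hθ' => hmono' (hbV θ hθ')) hs
  have hfdR := ae_mono hμ hfd
  have hα' : 0 < (α : ℝ) := hα
  have hfm : ∀ {F : Plane → ℂ} {C : ℝ≥0}, HolderOnWith C α F (closure (planeSector θm θM r)) →
      AEStronglyMeasurable F (volume.restrict (planeSector θm θM R)) := fun h =>
    ((h.continuousOn hα).mono (hsub.trans subset_closure)).aestronglyMeasurable
      (isOpen_planeSector hθM R).measurableSet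
  refine sub_eq_zero.1 (vertex_value_eq_zero (g := fun x => f x - f' x) (K := K + K') hθm hθ hθM
    hθ_ne hR (min_le_right _ _) hα' (by positivity) ((hfm hf).sub (hfm hf')) (fun x hx => ?_)
    (hwR.integrable one_le_two) fun s hs => ?_)
  · have hx' := subset_closure (hsub hx)
    have h1 := hf.dist_le hx' hcl
    have h2 := hf'.dist_le hx' hcl
    rw [dist_zero_right, dist_eq_norm] at h1 h2
    have h3 : f x - f' x - (f 0 - f' 0) = (f x - f 0) - (f' x - f' 0) := by ring
    rw [h3]
    exact (norm_sub_le _ _).trans (by linarith)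
  · rw [← hid s hs]
    refine integral_congr_ae ?_
    filter_upwards [hfdR] with x hx
    rw [hx]
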